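/- Let $F$ be a non-Archimedean local field with ring of integers $\mathfrak o$, maximal ideal $\mathfrak p=(\varpi)$ and residue field $\mathfrak o/\mathfrak p=\mathbb F_q$; put $\mathfrak o_k=\mathfrak o/\mathfrak p^k$ and $G=\mathrm{GL}_4(\mathfrak o_2)$. All representations are complex and (as all groups are finite) finite-dimensional. *Cuspidality.* For $n=n_1+n_2$ with $n_1,n_2>0$, let $P_{n_1,n_2}\subset \mathrm{GL}_n(\mathfrak o_k)$ be the group of block upper triangular matrices $\begin{pmatrix} a&b\\0&d\end{pmatrix}$ with diagonal blocks of sizes $n_1,n_2$, and let $U_{n_1,n_2}$ be the kernel of $P_{n_1,n_2}\to \mathrm{GL}_{n_1}(\mathfrak o_k)\times \mathrm{GL}_{n_2}(\mathfrak o_k)$, $\begin{pmatrix} a&b\\0&d\end{pmatrix}\mapsto(a,d)$. An irreducible representation of $\mathrm{GL}_n(\mathfrak o_k)$ is *geometrically induced* if, for some such $n_1,n_2$ and some representations $\sigma_i$ of $\mathrm{GL}_{n_i}(\mathfrak o_k)$, it is a subrepresentation of the representation induced from the pull-back of $\sigma_1\otimes\sigma_2$ to $P_{n_1,n_2}$.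 For a partition $\lambda=(\lambda_1\ge\lambda_2\ge\cdots)$ of a positive integer with at most $n$ parts, all at most $k$, regard $\mathfrak o_\lambda=\bigoplus_i\mathfrak o_{\lambda_i}$ as the submodule $\bigoplus_i\varpi^{k-\lambda_i}\mathfrak o_k e_i$ of $\mathfrak o_k^n$, and let $P_{\lambda\hookrightarrow k^n}$ be its stabilizer in $\mathrm{GL}_n(\mathfrak o_k)$. An irreducible representation is *infinitesimally induced* if, for some such $\lambda\neq k^n=(k,\dots,k)$ and some representation $\sigma$ of $\mathrm{Aut}(\mathfrak o_\lambda)$, it is a subrepresentation of the representation induced from the pull-back of $\sigma$ to $P_{\lambda\hookrightarrow k^n}$ along the restriction map $P_{\lambda\hookrightarrow k^n}\to\mathrm{Aut}(\mathfrak o_\lambda)$. An irreducible representation of $\mathrm{GL}_n(\mathfrak o_k)$ is *cuspidal* if none of its twists by a one-dimensional character of $\mathrm{GL}_n(\mathfrak o_k)$ is geometrically or infinitesimally induced. *Orbits.* Fix an additive character $\psi:F\to\mathbb C^\times$ that is trivial on $\mathfrak o$ and non-trivial on $\mathfrak p^{-1}$. Let $N_1=1+\varpi M_4(\mathfrak o_2)$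 be the kernel of the reduction map $G\to\mathrm{GL}_4(\mathbb F_q)$. For $\beta\in M_4(\mathbb F_q)$ let $\psi_\beta:N_1\to\mathbb C^\times$ be the character $\psi_\beta(1+\varpi x)=\psi(\varpi^{-1}\mathrm{Tr}(\beta x))$, and let $G(\psi_\beta)$ be its stabilizer in $G$ under conjugation. The *orbit* of an irreducible representation $\pi$ of $G$ is the set of all $\beta\in M_4(\mathbb F_q)$ such that $\pi|_{N_1}$ contains $\psi_\beta$. *Statement.* Let $\eta$ be a generator of the extension $\mathbb F_{q^2}/\mathbb F_q$, regarded as the element of $M_2(\mathbb F_q)$ given by multiplication by $\eta$ in the basis $\{1,\eta\}$, and put $\beta_2=\begin{pmatrix}\eta&0\\0&\eta\end{pmatrix}\in M_4(\mathbb F_q)$. Let $\pi$ be an irreducible representation of $G$ whose orbit contains $\beta_2$, and let $\rho$ be an irreducible representation of $G(\psi_{\beta_2})$ on whose space $N_1$ acts by the scalars $\psi_{\beta_2}$, such that $\pi\cong\mathrm{Ind}_{G(\psi_{\beta_2})}^{G}\rho$. Then $\pi$ is cuspidal if and only if the restriction of $\rho$ to $G(\psi_{\beta_2})\cap U_{2,2}$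 does not contain the trivial representation. -/

import Mathlib

open ValuativeRel Matrix
open scoped MatrixGroups TensorProduct

namespace CuspidalGL

noncomputable section

/-! ### Generalities on complex representations of (finite) groups -/

section Representations

variable {G : Type*} [Group G]

/-- The representation of `G` induced from a representation `ρ` of a subgroup `H`, on the space of
all functions `f : G → W` with `f (h * g) = ρ h (f g)` for `h ∈ H`, where `G` acts by right
translation, `(x • f) g = f (g * x)`. All groups below are finite. -/
abbrev induced {W : Type*} [AddCommGroup W] [Module ℂ W] (H : Subgroup G)
    (ρ : Representation ℂ H W) : Representation ℂ G (Representation.coindV H.subtype ρ) :=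
  Representation.coind H.subtype ρ

/-- The twist `χ ⊗ π` of a representation by a linear character. -/
def twist {V : Type*} [AddCommGroup V] [Module ℂ V] (χ : G →* ℂˣ) (π : Representation ℂ G V) :
    Representation ℂ G V where
  toFun g := (χ g : ℂ) • π g
  map_one' := by simp
  map_mul' g h := by
    ext v
    simp [mul_smul, smul_comm ((χ g : ℂˣ) : ℂ) ((χ h : ℂˣ) : ℂ)]

/-- The external tensor product, a representation of `G × G'` on `V ⊗ W`. -/
def extTensor {G' V W : Type*} [Group G'] [AddCommGroup V] [Module ℂ V] [AddCommGroup W]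
    [Module ℂ W] (σ : Representation ℂ G V) (τ : Representation ℂ G' W) :
    Representation ℂ (G × G') (V ⊗[ℂ] W) where
  toFun g := TensorProduct.map (σ g.1) (τ g.2)
  map_one' := by simp
  map_mul' g h := by simp [TensorProduct.map_mul]

/-- `π` is isomorphic to a subrepresentation of `σ`. -/
def IsSubrepOf {V W : Type*} [AddCommGroup V] [Module ℂ V] [AddCommGroup W] [Module ℂ W]
    (π : Representation ℂ G V) (σ : Representation ℂ G W) : Prop :=
  ∃ f : Representation.IntertwiningMap π σ, Function.Injective f

/-- The restriction of `π` to the subgroup `K` contains the trivial representation. -/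
def ContainsTrivialOn {V : Type*} [AddCommGroup V] [Module ℂ V]
    (π : Representation ℂ G V) (K : Subgroup G) : Prop :=
  IsSubrepOf (Representation.trivial ℂ K ℂ) (π.comp K.subtype)

/-- The stabilizer in `G` of a function (for example a character) on a normal subgroup `N`, for
the action of `G` by conjugation. -/
def charStabilizer {X : Type*} (N : Subgroup G) [N.Normal] (χ : N → X) : Subgroup G where
  carrier := {g | ∀ n : N, χ (MulAut.conjNormal g n) = χ n}
  one_mem' n := by simp
  mul_mem' {a b} ha hb n := by
    rw [map_mul, MulAut.mul_apply, ha, hb]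
  inv_mem' {a} ha n := by
    rw [← ha, ← MulAut.mul_apply, ← map_mul]
    simp

end Representations

/-! ### Geometric induction for `GL_n` over a commutative ring -/

section Geometric

variable (R : Type*) [CommRing R] {n : ℕ} (n₁ n₂ : ℕ) (h : n₁ + n₂ = n)

/-- The identification `{0, …, n₁ - 1} ⊔ {0, …, n₂ - 1} ≃ {0, …, n - 1}` for `n = n₁ + n₂`, the
first block coming first. -/
def blockEquiv : Fin n₁ ⊕ Fin n₂ ≃ Fin n := finSumFinEquiv.trans (finCongr h)

variable {R n₁ n₂} in
/-- A matrix of size `n = n₁ + n₂`, written in blocks. -/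
def blockForm (A : Matrix (Fin n) (Fin n) R) : Matrix (Fin n₁ ⊕ Fin n₂) (Fin n₁ ⊕ Fin n₂) R :=
  A.submatrix (blockEquiv n₁ n₂ h) (blockEquiv n₁ n₂ h)

variable {R n₁ n₂} in
theorem blockForm_mul (A B : Matrix (Fin n) (Fin n) R) :
    blockForm h (A * B) = blockForm h A * blockForm h B := by
  simp [blockForm, Matrix.submatrix_mul_equiv]

variable {R n₁ n₂} in
theorem blockForm_one : blockForm h (1 : Matrix (Fin n) (Fin n) R) = 1 := by
  simp [blockForm]

variable {R n₁ n₂} in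
theorem toBlocks_mul (A B : Matrix (Fin n₁ ⊕ Fin n₂) (Fin n₁ ⊕ Fin n₂) R) :
    (A * B).toBlocks₁₁ = A.toBlocks₁₁ * B.toBlocks₁₁ + A.toBlocks₁₂ * B.toBlocks₂₁ ∧
    (A * B).toBlocks₂₁ = A.toBlocks₂₁ * B.toBlocks₁₁ + A.toBlocks₂₂ * B.toBlocks₂₁ ∧
    (A * B).toBlocks₂₂ = A.toBlocks₂₁ * B.toBlocks₁₂ + A.toBlocks₂₂ * B.toBlocks₂₂ := by
  have := Matrix.fromBlocks_multiply A.toBlocks₁₁ A.toBlocks₁₂ A.toBlocks₂₁ A.toBlocks₂₂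
    B.toBlocks₁₁ B.toBlocks₁₂ B.toBlocks₂₁ B.toBlocks₂₂
  rw [Matrix.fromBlocks_toBlocks, Matrix.fromBlocks_toBlocks] at this
  rw [this]
  simp

/-- The group `P_{n₁,n₂}` of block upper triangular matrices in `GL_n(R)`, that is, the subgroup
preserving `R^{n₁}` in `R^n = R^{n₁} ⊕ R^{n₂}`. -/
def geomP : Subgroup (GL (Fin n) R) where
  carrier := {g | (blockForm h g.val).toBlocks₂₁ = 0}
  one_mem' := by
    simp only [Set.mem_ofPred_eq, Units.val_one, blockForm_one]
    rw [← Matrix.fromBlocks_one]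
    rfl
  mul_mem' {a b} ha hb := by
    simp only [Set.mem_ofPred_eq, Units.val_mul, blockForm_mul] at *
    rw [(toBlocks_mul _ _).2.1, ha, hb]
    simp
  inv_mem' {a} ha := by
    simp only [Set.mem_ofPred_eq] at *
    have h1 : blockForm h a.val * blockForm h (a⁻¹).val = 1 := by
      rw [← blockForm_mul, ← Units.val_mul, mul_inv_cancel, Units.val_one, blockForm_one]
    have h2 := (toBlocks_mul (blockForm h a.val) (blockForm h (a⁻¹).val)).2
    rw [h1, ha, ← Matrix.fromBlocks_one, Matrix.toBlocks_fromBlocks₂₁,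
      Matrix.toBlocks_fromBlocks₂₂] at h2
    simp only [Matrix.zero_mul, zero_add] at h2
    have h3 := mul_eq_one_comm.mp h2.2.symm
    calc (blockForm h (a⁻¹).val).toBlocks₂₁
        = ((blockForm h (a⁻¹).val).toBlocks₂₂ * (blockForm h a.val).toBlocks₂₂) *
            (blockForm h (a⁻¹).val).toBlocks₂₁ := by rw [h3, Matrix.one_mul]
      _ = 0 := by rw [Matrix.mul_assoc, ← h2.1, Matrix.mul_zero]

/-- The surjection `φ : P_{n₁,n₂} → GL_{n₁}(R) × GL_{n₂}(R)` given by the diagonal blocks. -/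
def geomPhi : geomP R n₁ n₂ h →* GL (Fin n₁) R × GL (Fin n₂) R :=
  MonoidHom.prod
    (MonoidHom.toHomUnits
      { toFun := fun g => (blockForm h g.val.val).toBlocks₁₁
        map_one' := by
          simp only [OneMemClass.coe_one, Units.val_one, blockForm_one]
          rw [← Matrix.fromBlocks_one]
          rfl
        map_mul' := fun a b => by
          have hb : (blockForm h b.val.val).toBlocks₂₁ = 0 := b.2
          simp only [Subgroup.coe_mul, Units.val_mul, blockForm_mul]
          rw [(toBlocks_mul _ _).1, hb]
          simp })
    (MonoidHom.toHomUnits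
      { toFun := fun g => (blockForm h g.val.val).toBlocks₂₂
        map_one' := by
          simp only [OneMemClass.coe_one, Units.val_one, blockForm_one]
          rw [← Matrix.fromBlocks_one]
          rfl
        map_mul' := fun a b => by
          have ha : (blockForm h a.val.val).toBlocks₂₁ = 0 := a.2
          simp only [Subgroup.coe_mul, Units.val_mul, blockForm_mul]
          rw [(toBlocks_mul _ _).2.2, ha]
          simp })

/-- The group `U_{n₁,n₂} = ker φ`, viewed as a subgroup of `GL_n(R)`. -/
def geomU : Subgroup (GL (Fin n) R) :=
  (geomPhi R n₁ n₂ h).ker.map (geomP R n₁ n₂ h).subtype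

/-- The representation `σ₁ ⊗ σ₂` of `GL_{n₁}(R) × GL_{n₂}(R)`, pulled back to `P_{n₁,n₂}`. -/
def geomInfl {W₁ W₂ : Type*} [AddCommGroup W₁] [Module ℂ W₁] [AddCommGroup W₂] [Module ℂ W₂]
    (σ₁ : Representation ℂ (GL (Fin n₁) R) W₁) (σ₂ : Representation ℂ (GL (Fin n₂) R) W₂) :
    Representation ℂ (geomP R n₁ n₂ h) (W₁ ⊗[ℂ] W₂) :=
  (extTensor σ₁ σ₂).comp (geomPhi R n₁ n₂ h)

variable {R} in
/-- `π` lies in the geometrically induced series: it is a subrepresentation of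
`i_{n₁,n₂}(σ₁, σ₂)`, the representation induced from the pull-back of `σ₁ ⊗ σ₂` to `P_{n₁,n₂}`. -/
def IsGeomInduced {V : Type*} [AddCommGroup V] [Module ℂ V]
    (π : Representation ℂ (GL (Fin n) R) V) : Prop :=
  ∃ (n₁ n₂ : ℕ) (h : n₁ + n₂ = n), 0 < n₁ ∧ 0 < n₂ ∧
    ∃ (W₁ W₂ : Type) (_ : AddCommGroup W₁) (_ : Module ℂ W₁) (_ : AddCommGroup W₂)
      (_ : Module ℂ W₂) (_ : FiniteDimensional ℂ W₁) (_ : FiniteDimensional ℂ W₂)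
      (σ₁ : Representation ℂ (GL (Fin n₁) R) W₁) (σ₂ : Representation ℂ (GL (Fin n₂) R) W₂),
      IsSubrepOf π (induced (geomP R n₁ n₂ h) (geomInfl R n₁ n₂ h σ₁ σ₂))

end Geometric

/-! ### The rings `𝔬_k` and infinitesimal induction for `GL_n(𝔬_k)` -/

section LocalField

variable (F : Type*) [Field F] [ValuativeRel F]

/-- The ring `𝔬_k = 𝔬 / 𝔭^k`. -/
abbrev Ok (k : ℕ) : Type _ := 𝒪[F] ⧸ 𝓂[F] ^ k

/-- The image of `𝔬_λ = ⨁ᵢ 𝔬_{λᵢ}` in `𝔬_k^n` under the embedding `fᵢ ↦ ϖ^{k - λᵢ} eᵢ`, that is,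
the submodule `⨁ᵢ 𝔭^{k - λᵢ} 𝔬_k eᵢ`. A partition of length at most `n` is given here by its `n`
parts, some of which may be `0`. -/
def partSubmodule (k : ℕ) {n : ℕ} (lam : Fin n → ℕ) : Submodule (Ok F k) (Fin n → Ok F k) :=
  Submodule.pi Set.univ
    fun i => (𝓂[F] ^ (k - lam i)).map (Ideal.Quotient.mk (𝓂[F] ^ k))

/-- The group `P_{λ ↪ k^n}` of all `g` in `GL_n(𝔬_k)` with `g 𝔬_λ = 𝔬_λ`. -/
def infP (k : ℕ) {n : ℕ} (lam : Fin n → ℕ) : Subgroup (GL (Fin n) (Ok F k)) where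
  carrier := {g | (partSubmodule F k lam).map (Matrix.mulVecLin g.val) = partSubmodule F k lam}
  one_mem' := by simp
  mul_mem' {a b} ha hb := by
    simp only [Set.mem_ofPred_eq, Units.val_mul, Matrix.mulVecLin_mul] at *
    rw [Submodule.map_comp, hb, ha]
  inv_mem' {a} ha := by
    simp only [Set.mem_ofPred_eq] at *
    conv_lhs => rw [← ha]
    rw [← Submodule.map_comp, ← Matrix.mulVecLin_mul, ← Units.val_mul, inv_mul_cancel]
    simp

/-- The group `G_λ` of automorphisms of the module `𝔬_λ`. -/
abbrev GLam (k : ℕ) {n : ℕ} (lam : Fin n → ℕ) : Type _ :=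
  LinearMap.GeneralLinearGroup (Ok F k) (partSubmodule F k lam)

theorem infP_mapsTo {k n : ℕ} {lam : Fin n → ℕ} (g : infP F k lam) :
    ∀ v ∈ partSubmodule F k lam, Matrix.mulVecLin g.val.val v ∈ partSubmodule F k lam := by
  intro v hv
  have hg : (partSubmodule F k lam).map (Matrix.mulVecLin g.val.val) = partSubmodule F k lam := g.2
  rw [← hg]
  exact Submodule.mem_map_of_mem hv

/-- The homomorphism `P_{λ ↪ k^n} → G_λ` given by restriction to `𝔬_λ`. -/
def infPhi (k : ℕ) {n : ℕ} (lam : Fin n → ℕ) : infP F k lam →* GLam F k lam :=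
  MonoidHom.toHomUnits
    { toFun := fun g => (Matrix.mulVecLin g.val.val).restrict (infP_mapsTo F g)
      map_one' := by
        ext v
        simp
      map_mul' := fun a b => by
        ext v
        simp [Matrix.mulVec_mulVec] }

variable {F}

/-- `π` lies in the infinitesimally induced series: it is a subrepresentation of
`i_{λ ↪ k^n}(σ)`, the representation induced from the pull-back of `σ` to `P_{λ ↪ k^n}`, for a
partition `λ ≤ k^n`, `λ ≠ k^n`, and a representation `σ` of `G_λ`. (For `λ = k^n` the functor
`i_{λ ↪ k^n}` is the identity.) -/
def IsInfInduced {k n : ℕ} {V : Type*} [AddCommGroup V] [Module ℂ V]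
    (π : Representation ℂ (GL (Fin n) (Ok F k)) V) : Prop :=
  ∃ lam : Fin n → ℕ, Antitone lam ∧ (∀ i, lam i ≤ k) ∧ (∃ i, lam i ≠ 0) ∧ (∃ i, lam i ≠ k) ∧
    ∃ (W : Type) (_ : AddCommGroup W) (_ : Module ℂ W) (_ : FiniteDimensional ℂ W)
      (σ : Representation ℂ (GLam F k lam) W),
        IsSubrepOf π (induced (infP F k lam) (σ.comp (infPhi F k lam)))

/-- An irreducible representation of `GL_n(𝔬_k)` is cuspidal if no twist of it by a linear
character lies in the geometrically or in the infinitesimally induced series. -/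
def IsCuspidal {k n : ℕ} {V : Type*} [AddCommGroup V] [Module ℂ V]
    (π : Representation ℂ (GL (Fin n) (Ok F k)) V) : Prop :=
  π.IsIrreducible ∧ ∀ χ : GL (Fin n) (Ok F k) →* ℂˣ,
    ¬ IsGeomInduced (twist χ π) ∧ ¬ IsInfInduced (twist χ π)

/-! ### The characters `ψ_β` of `N₁` -/

variable (F)

/-- Reduction `𝔬_2 → 𝔬_1 = 𝔬 / 𝔭`. -/
def red : Ok F 2 →+* 𝓀[F] :=
  Ideal.Quotient.lift (𝓂[F] ^ 2) (IsLocalRing.residue 𝒪[F]) fun _ ha =>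
    (IsLocalRing.residue_eq_zero_iff _).mpr (Ideal.pow_le_self two_ne_zero ha)

/-- The kernel `N₁` of the reduction map `GL_n(𝔬_2) → GL_n(𝔬_1)`. -/
def N1 (n : ℕ) : Subgroup (GL (Fin n) (Ok F 2)) :=
  (Matrix.GeneralLinearGroup.map (n := Fin n) (red F)).ker

instance (n : ℕ) : (N1 F n).Normal := inferInstanceAs (MonoidHom.ker _).Normal

variable {F}

/-- A matrix over `𝔬` lifting a given matrix over `𝔬_1`. -/
def liftRes {n : ℕ} (β : Matrix (Fin n) (Fin n) 𝓀[F]) : Matrix (Fin n) (Fin n) 𝒪[F] :=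
  β.map (Function.surjInv (IsLocalRing.residue_surjective (R := 𝒪[F])))

/-- A matrix over `𝔬` lifting a given matrix over `𝔬_2`. -/
def liftTwo {n : ℕ} (A : Matrix (Fin n) (Fin n) (Ok F 2)) : Matrix (Fin n) (Fin n) 𝒪[F] :=
  A.map (Function.surjInv (Ideal.Quotient.mk_surjective (I := 𝓂[F] ^ 2)))

/-- The function `ψ_β` on `N₁`: for `g = 1 + ϖ x` in `N₁`, with lifts `g'` of `g` and `β'` of `β`
to `𝔬`, it is `ψ (ϖ^{-2} Tr (β' (g' - 1))) = ψ (ϖ^{-1} Tr (β x))`; see `psiFun_eq`. -/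
def psiFun (ψ : AddChar F ℂ) (ϖ : 𝒪[F]) {n : ℕ} (β : Matrix (Fin n) (Fin n) 𝓀[F])
    (g : N1 F n) : ℂ :=
  ψ (((ϖ : F) ^ 2)⁻¹ * ((liftRes β * (liftTwo g.val.val - 1)).trace : 𝒪[F]))

theorem liftRes_map {n : ℕ} (β : Matrix (Fin n) (Fin n) 𝓀[F]) :
    (liftRes β).map (IsLocalRing.residue 𝒪[F]) = β := by
  ext i j
  simp [liftRes, Function.surjInv_eq]

theorem liftTwo_map {n : ℕ} (A : Matrix (Fin n) (Fin n) (Ok F 2)) :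
    (liftTwo A).map (Ideal.Quotient.mk (𝓂[F] ^ 2)) = A := by
  ext i j
  exact Function.surjInv_eq (Ideal.Quotient.mk_surjective (I := 𝓂[F] ^ 2)) (A i j)

theorem trace_congr {I J K : Ideal 𝒪[F]} (hIJ : I * J ≤ K) {n : ℕ}
    {A X : Matrix (Fin n) (Fin n) 𝒪[F]} (hA : ∀ i j, A i j ∈ I) (hX : ∀ i j, X i j ∈ J) :
    (A * X).trace ∈ K :=
  K.sum_mem fun i _ => by
    rw [Matrix.diag_apply, Matrix.mul_apply]
    exact K.sum_mem fun j _ => hIJ (Ideal.mul_mem_mul (hA i j) (hX j i))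

theorem lift_sub_one_mem {n : ℕ} (Y : Matrix (Fin n) (Fin n) 𝒪[F]) (g : N1 F n)
    (hg : Y.map (Ideal.Quotient.mk (𝓂[F] ^ 2)) = g.val.val) (i j : Fin n) :
    (Y - 1) i j ∈ 𝓂[F] := by
  have h1 : Matrix.GeneralLinearGroup.map (n := Fin n) (red F) g.val = 1 := g.2
  have h2 : (Matrix.GeneralLinearGroup.map (n := Fin n) (red F) g.val).val i j =
      (1 : Matrix (Fin n) (Fin n) 𝓀[F]) i j := by
    rw [h1]
    rfl
  rw [Matrix.GeneralLinearGroup.map_apply, ← hg] at h2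
  have h3 : IsLocalRing.residue 𝒪[F] (Y i j) = (1 : Matrix (Fin n) (Fin n) 𝓀[F]) i j := h2
  rw [← IsLocalRing.residue_eq_zero_iff, Matrix.sub_apply, map_sub, h3]
  by_cases hij : i = j
  · subst hij
    simp
  · simp [hij]

variable [TopologicalSpace F] [IsNonarchimedeanLocalField F]

theorem psi_congr {ψ : AddChar F ℂ} (hψ : ∀ x : 𝒪[F], ψ (x : F) = 1) {ϖ : 𝒪[F]}
    (hϖ : Irreducible ϖ) {a b : 𝒪[F]} (hab : a - b ∈ 𝓂[F] ^ 2) :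
    ψ (((ϖ : F) ^ 2)⁻¹ * (a : F)) = ψ (((ϖ : F) ^ 2)⁻¹ * (b : F)) := by
  rw [hϖ.maximalIdeal_eq, Ideal.span_singleton_pow, Ideal.mem_span_singleton] at hab
  obtain ⟨c, hc⟩ := hab
  have h0 : (ϖ : F) ≠ 0 := by
    intro h
    exact hϖ.ne_zero (Subtype.ext h)
  have h1 : (a : F) = b + (ϖ : F) ^ 2 * c := by
    have : a = b + ϖ ^ 2 * c := by rw [← hc]; ring
    rw [this]
    push_cast
    rfl
  rw [h1, mul_add, AddChar.map_add_eq_mul, inv_mul_cancel_left₀ (pow_ne_zero 2 h0), hψ, mul_one]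

theorem psiFun_lift {ψ : AddChar F ℂ} (hψ : ∀ x : 𝒪[F], ψ (x : F) = 1) {ϖ : 𝒪[F]}
    (hϖ : Irreducible ϖ) {n : ℕ} (B Y : Matrix (Fin n) (Fin n) 𝒪[F]) (g : N1 F n)
    (hg : Y.map (Ideal.Quotient.mk (𝓂[F] ^ 2)) = g.val.val) :
    psiFun ψ ϖ (B.map (IsLocalRing.residue 𝒪[F])) g =
      ψ (((ϖ : F) ^ 2)⁻¹ * ((B * (Y - 1)).trace : 𝒪[F])) := by
  set B' := liftRes (B.map (IsLocalRing.residue 𝒪[F])) with hB'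
  set Y' := liftTwo g.val.val with hY'
  have hBB : ∀ i j, (B' - B) i j ∈ 𝓂[F] := by
    intro i j
    have := congrFun (congrFun (liftRes_map (B.map (IsLocalRing.residue 𝒪[F]))) i) j
    rw [← hB'] at this
    simp only [Matrix.map_apply] at this
    rw [← IsLocalRing.residue_eq_zero_iff, Matrix.sub_apply, map_sub, this, sub_self]
  have hYY : ∀ i j, (Y' - Y) i j ∈ 𝓂[F] ^ 2 := by
    intro i j
    have := congrFun (congrFun ((liftTwo_map g.val.val).trans hg.symm) i) j
    simp only [Matrix.map_apply] at this
    exact Ideal.Quotient.eq.mp this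
  have hY1 : ∀ i j, (Y - 1) i j ∈ 𝓂[F] := lift_sub_one_mem Y g hg
  refine psi_congr hψ hϖ ?_
  have key : (B' * (Y' - 1)).trace - (B * (Y - 1)).trace =
      (B' * (Y' - Y)).trace + ((B' - B) * (Y - 1)).trace := by
    rw [← Matrix.trace_sub, ← Matrix.trace_add]
    congr 1
    noncomm_ring
  rw [key]
  refine Ideal.add_mem _ ?_ ?_
  · exact trace_congr (I := ⊤) (K := 𝓂[F] ^ 2) Ideal.mul_le_right (fun _ _ => trivial) hYY
  · exact trace_congr (le_of_eq (pow_two _).symm) hBB hY1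

/-- The defining formula `ψ_β (1 + ϖ x) = ψ (ϖ^{-1} Tr (β x))`, where `β` and `x` are lifted
to `𝔬`. -/
theorem psiFun_eq {ψ : AddChar F ℂ} (hψ : ∀ x : 𝒪[F], ψ (x : F) = 1) {ϖ : 𝒪[F]}
    (hϖ : Irreducible ϖ) {n : ℕ} (B X : Matrix (Fin n) (Fin n) 𝒪[F]) (g : N1 F n)
    (hg : (1 + ϖ • X).map (Ideal.Quotient.mk (𝓂[F] ^ 2)) = g.val.val) :
    psiFun ψ ϖ (B.map (IsLocalRing.residue 𝒪[F])) g =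
      ψ ((ϖ : F)⁻¹ * ((B * X).trace : 𝒪[F])) := by
  have h0 : (ϖ : F) ≠ 0 := by
    intro h
    exact hϖ.ne_zero (Subtype.ext h)
  rw [psiFun_lift hψ hϖ B _ g hg, add_sub_cancel_left, Matrix.mul_smul, Matrix.trace_smul]
  congr 1
  rw [smul_eq_mul]
  push_cast
  field_simp

/-- The character `ψ_β : N₁ → ℂˣ`, `1 + ϖ x ↦ ψ (ϖ^{-1} Tr (β x))`. -/
def psi (ψ : AddChar F ℂ) (hψ : ∀ x : 𝒪[F], ψ (x : F) = 1) (ϖ : 𝒪[F]) (hϖ : Irreducible ϖ)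
    {n : ℕ} (β : Matrix (Fin n) (Fin n) 𝓀[F]) : N1 F n →* ℂˣ :=
  MonoidHom.toHomUnits
    { toFun := psiFun ψ ϖ β
      map_one' := by
        have := psiFun_lift hψ hϖ (liftRes β) 1 (1 : N1 F n) (by simp)
        rw [liftRes_map] at this
        rw [this]
        simp
      map_mul' := fun a b => by
        have := psiFun_lift hψ hϖ (liftRes β) (liftTwo a.val.val * liftTwo b.val.val) (a * b)
          (by rw [Matrix.map_mul, liftTwo_map, liftTwo_map]; rfl)
        rw [liftRes_map] at this
        rw [this]
        unfold psiFun
        rw [← AddChar.map_add_eq_mul, ← mul_add, ← Subring.coe_add]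
        refine psi_congr hψ hϖ ?_
        have key : (liftRes β * (liftTwo a.val.val * liftTwo b.val.val - 1)).trace -
            ((liftRes β * (liftTwo a.val.val - 1)).trace +
              (liftRes β * (liftTwo b.val.val - 1)).trace) =
            (liftRes β * (liftTwo a.val.val - 1) * (liftTwo b.val.val - 1)).trace := by
          rw [← Matrix.trace_add, ← Matrix.trace_sub]
          congr 1
          noncomm_ring
        rw [key]
        refine trace_congr (le_of_eq (pow_two _).symm) ?_
          (lift_sub_one_mem _ b (liftTwo_map _))
        intro i j
        rw [Matrix.mul_apply]
        exact Ideal.sum_mem _ fun l _ =>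
          Ideal.mul_mem_left _ _ (lift_sub_one_mem _ a (liftTwo_map _) l j) }

/-- The orbit of a representation `π` of `GL_n(𝔬_2)`: the set of all `β` in `M_n(𝔬_1)` such that
the restriction of `π` to `N₁` contains the character `ψ_β`. -/
def orbit (ψ : AddChar F ℂ) (hψ : ∀ x : 𝒪[F], ψ (x : F) = 1) (ϖ : 𝒪[F]) (hϖ : Irreducible ϖ)
    {n : ℕ} {V : Type*} [AddCommGroup V] [Module ℂ V]
    (π : Representation ℂ (GL (Fin n) (Ok F 2)) V) : Set (Matrix (Fin n) (Fin n) 𝓀[F]) :=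
  {β | ∃ v : V, v ≠ 0 ∧ ∀ g : N1 F n, π g v = (psi ψ hψ ϖ hϖ β g : ℂ) • v}

/-- The block diagonal matrix `diag(A, A)` in `M_4`, for `A` in `M_2`. -/
def diagTwo {R : Type*} [Zero R] (A : Matrix (Fin 2) (Fin 2) R) : Matrix (Fin 4) (Fin 4) R :=
  Matrix.reindex (blockEquiv 2 2 rfl) (blockEquiv 2 2 rfl) (Matrix.fromBlocks A 0 0 A)

/-- The matrix `β₂ = diag(η, η)` in `M_4(𝔬_1)`, where an element `η` of a quadratic extension `E`
is identified with the matrix of multiplication by `η` in the basis `b` of `E` over `𝔬_1`. -/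
def beta2 {E : Type*} [Field E] [Algebra 𝓀[F] E] (b : Module.Basis (Fin 2) 𝓀[F] E) (η : E) :
    Matrix (Fin 4) (Fin 4) 𝓀[F] :=
  diagTwo (Algebra.leftMulMatrix b η)

/-- The stabilizer `G(ψ_β)` of the character `ψ_β` of `N₁` in `G = GL_n(𝔬_2)`. -/
def Gpsi (ψ : AddChar F ℂ) (hψ : ∀ x : 𝒪[F], ψ (x : F) = 1) (ϖ : 𝒪[F]) (hϖ : Irreducible ϖ)
    {n : ℕ} (β : Matrix (Fin n) (Fin n) 𝓀[F]) : Subgroup (GL (Fin n) (Ok F 2)) :=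
  charStabilizer (N1 F n) (psi ψ hψ ϖ hϖ β)

end LocalField

end

end CuspidalGL

/-! Everything is read off from fixed vectors. If a representation embeds in one induced from the
inflation of `σ` along `φ : P → Q`, it has a nonzero vector fixed by `ker φ`; conversely, an
irreducible representation with a vector fixed by `U_{n₁,n₂}` is geometrically induced, since
regular representations can serve as `σ₁` and `σ₂`. Realize `π` as functions `f` on `G` with `f (s
g) = ρ s (f g)` for `s ∈ G(ψ_β)`.

If `ρ` fixes `w ≠ 0` on `G(ψ_β) ∩ U_{2,2}`, then `w` spreads to a `U_{2,2}`-fixed function supported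
on `G(ψ_β) U_{2,2}`, so `π` itself is geometrically induced.

For the converse, suppose a twist of `π` is induced, and take a fixed vector, seen as a function `f`
with `f x ≠ 0`. Characters of `G` are trivial on the relevant unipotent elements, because these are
commutators (`character_elementary`, `character_geomU`), so the twist drops out. With `γ = x⁻¹ β x`
over the residue field, `f (x z) = ψ_γ(z) f x` on `N₁`; invariance under `1 + c Eᵢⱼ` for all `c` in
the maximal ideal therefore forces `γ j i = 0` (`offDiag_eq_zero_of_fixed`). But `γ` is annihilated
by an irreducible quadratic polynomial, so no row or column of it can vanish off the diagonal.

Infinitesimal induction would kill an off-diagonal row, which is impossible. Geometric induction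
makes `γ` block triangular, and blocks of size 1 are excluded in the same way, leaving `n₁ = n₂ =
2`. Then `β` preserves the plane spanned by the first two columns of `x`, a line over the quadratic
field `k[β]`, where `k` is the residue field. The centralizer of `β` is transitive on such lines
(`exists_commute_mul_blockTriangular`), so `x ∈ G(ψ_β) P_{2,2}`, and `f` at the `P_{2,2}` component
is the required vector fixed by `G(ψ_β) ∩ U_{2,2}`. -/

namespace CuspidalGL

noncomputable section

/-! ### Fixed vectors and Frobenius reciprocity for finite groups. -/

section Representations

variable {G : Type*} [Group G] {V W X : Type*} [AddCommGroup V] [Module ℂ V] [AddCommGroup W]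
  [Module ℂ W] [AddCommGroup X] [Module ℂ X]

/-- The sum of the `U`-translates of `v` is fixed, and `L` takes on it the value `|U| • L v`, which
is nonzero in characteristic zero. -/
theorem exists_fixed_of_invariant_map (π : Representation ℂ G V) (U : Subgroup G) [Finite U]
    (L : V →ₗ[ℂ] X) (hL : ∀ u ∈ U, ∀ v, L (π u v) = L v) (h0 : L ≠ 0) :
    ∃ v : V, v ≠ 0 ∧ ∀ u ∈ U, π u v = v := by
  have := Fintype.ofFinite U
  obtain ⟨v, hv⟩ : ∃ v, L v ≠ 0 := by
    by_contra! h
    exact h0 (LinearMap.ext h)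
  refine ⟨∑ u : U, π u.1 v, ?_, ?_⟩
  · intro h
    have h1 : L (∑ u : U, π u.1 v) = (Fintype.card U : ℂ) • L v := by
      rw [map_sum, Finset.sum_congr rfl fun u _ => hL u.1 u.2 v]
      simp [Nat.cast_smul_eq_nsmul]
    rw [h, map_zero] at h1
    exact hv ((smul_eq_zero.mp h1.symm).resolve_left (by simp [Fintype.card_ne_zero]))
  · intro u hu
    rw [map_sum]
    refine Fintype.sum_equiv (Equiv.mulLeft ⟨u, hu⟩) _ _ fun x => ?_
    simp

theorem exists_invariant_functional_of_fixed (π : Representation ℂ G V) (U : Subgroup G) [Finite U]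
    {v : V} (hv : v ≠ 0) (h : ∀ u ∈ U, π u v = v) :
    ∃ L : V →ₗ[ℂ] ℂ, L v ≠ 0 ∧ ∀ u ∈ U, ∀ x, L (π u x) = L x := by
  classical
  have := Fintype.ofFinite U
  obtain ⟨l, hl⟩ := Module.Projective.exists_dual_ne_zero ℂ hv
  refine ⟨∑ u : U, l ∘ₗ π u.1, ?_, ?_⟩
  · have h1 : (∑ u : U, l ∘ₗ π u.1) v = (Fintype.card U : ℂ) * l v := by
      have h2 : ∀ u : U, (l ∘ₗ π u.1) v = l v := fun u => congrArg l (h u.1 u.2)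
      rw [LinearMap.sum_apply, Finset.sum_congr rfl fun u _ => h2 u]
      simp
    rw [h1]
    exact mul_ne_zero (by simp [Fintype.card_ne_zero]) hl
  · intro u hu x
    rw [LinearMap.sum_apply, LinearMap.sum_apply]
    refine Fintype.sum_equiv (Equiv.mulRight ⟨u, hu⟩) _ _ fun y => ?_
    simp

/-- Frobenius reciprocity, in the form of a vector fixed by the kernel of the inducing
representation. -/
theorem exists_fixed_of_isSubrepOf_induced [Finite G] [Nontrivial V] {π : Representation ℂ G V}
    {H : Subgroup G} {σ : Representation ℂ H W} (h : IsSubrepOf π (induced H σ)) :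
    ∃ v : V, v ≠ 0 ∧ ∀ u : H, σ u = 1 → π u v = v := by
  obtain ⟨T, hT⟩ := h
  have hTe : ∀ (g : G) (v : V) (x : G), (T (π g v)).1 x = (T v).1 (x * g) := by
    intro g v x
    rw [T.isIntertwining]
    rfl
  let L : V →ₗ[ℂ] W :=
    LinearMap.proj (1 : G) ∘ₗ (Representation.coindV H.subtype σ).subtype ∘ₗ T.toLinearMap
  have hLT : ∀ v, L v = (T v).1 1 := fun _ => rfl
  let K : Subgroup H := MonoidHom.ker σ.asGroupHom
  obtain ⟨v, hv, hv'⟩ := exists_fixed_of_invariant_map π (K.map H.subtype) L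
    (by
      rintro _ ⟨u, hu, rfl⟩ v
      have hu' : σ u = 1 := congrArg Units.val hu
      rw [hLT, hLT, hTe]
      have := (T v).2 u 1
      rw [mul_one] at this
      rw [one_mul, this, hu']
      rfl)
    (by
      intro hL
      obtain ⟨v, hv⟩ := exists_ne (0 : V)
      apply hv
      apply hT
      rw [map_zero]
      apply Subtype.ext
      funext g
      -- The value at 1 of the image of `π g v` is the value at `g` of the image of `v`, so `L`
      -- determines `T`.
      have := LinearMap.congr_fun hL (π g v)
      rw [hLT, hTe, one_mul] at this
      exact this)
  refine ⟨v, hv, fun u hu => hv' u ⟨u, Units.ext hu, rfl⟩⟩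

/-- The function is supported on `S U`: it sums `ρ s w` over the `s` with `g ∈ s U`, and its value
at 1 is `|S ∩ U| • w`. -/
theorem exists_fixed_induced [Finite G] {S : Subgroup G} (ρ : Representation ℂ S W)
    (U : Subgroup G) {w : W} (hw : w ≠ 0) (h : ∀ s : S, s.1 ∈ U → ρ s w = w) :
    ∃ f : Representation.coindV S.subtype ρ, f ≠ 0 ∧ ∀ u ∈ U, induced S ρ u f = f := by
  classical
  have := Fintype.ofFinite S
  refine ⟨⟨fun g => ∑ s : S, if s.1⁻¹ * g ∈ U then ρ s w else 0, ?_⟩, ?_, ?_⟩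
  · intro s g
    rw [map_sum]
    symm
    refine Fintype.sum_equiv (Equiv.mulLeft s) _ _ fun x => ?_
    have : ((s * x : S) : G)⁻¹ * (S.subtype s * g) = x.1⁻¹ * g := by
      simp [mul_assoc]
    simp only [Equiv.coe_mulLeft, this]
    split_ifs
    · simp
    · simp
  · intro hf
    have h1 := congrFun (congrArg Subtype.val hf) 1
    simp only [mul_one, inv_mem_iff] at h1
    rw [Finset.sum_congr rfl (g := fun s : S => if s.1 ∈ U then w else 0)
      (fun s _ => by split_ifs with hs <;> simp [h s, hs]), ← Finset.sum_filter,
      Finset.sum_const] at h1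
    have h2 : (Finset.univ.filter fun s : S => s.1 ∈ U).card • w = 0 := h1
    rw [← Nat.cast_smul_eq_nsmul ℂ] at h2
    refine hw ((smul_eq_zero.mp h2).resolve_left ?_)
    exact Nat.cast_ne_zero.mpr (Finset.card_ne_zero.mpr ⟨1, by simp⟩)
  · intro u hu
    apply Subtype.ext
    funext g
    refine Finset.sum_congr rfl fun s _ => ?_
    rw [← mul_assoc, Subgroup.mul_mem_cancel_right U hu]

theorem isSubrepOf_of_ne_zero {π : Representation ℂ G V} (hπ : π.IsIrreducible)
    {σ : Representation ℂ G W} (T : Representation.IntertwiningMap π σ) {v : V} (hv : T v ≠ 0) :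
    IsSubrepOf π σ := by
  refine ⟨T, (hπ.injective_or_eq_zero T).resolve_right ?_⟩
  rintro rfl
  exact hv rfl

/-- The left regular representation, on functions. -/
def leftRegularFun (A : Type*) [Group A] : Representation ℂ A (A → ℂ) where
  toFun a := LinearMap.funLeft ℂ ℂ fun x => a⁻¹ * x
  map_one' := by
    ext
    simp [LinearMap.funLeft]
  map_mul' a b := by
    ext
    simp [LinearMap.funLeft, mul_assoc]

theorem leftRegularFun_single {A : Type*} [Group A] [DecidableEq A] (a x : A) :
    leftRegularFun A a (Pi.single x 1) = Pi.single (a * x) 1 := by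
  ext y
  simp [leftRegularFun, LinearMap.funLeft, Pi.single_apply, inv_mul_eq_iff_eq_mul]

/-- The regular representation of `A × B` is the external tensor product of two regular
representations. A `ker φ`-invariant functional `L` sends `v` to the function on `G` whose
coefficients are `L` of translates of `v`; irreducibility makes this nonzero map injective. -/
theorem isSubrepOf_induced_extTensor [Finite G] {A B : Type*} [Group A] [Group B] [Finite A]
    [Finite B] {P : Subgroup G} {φ : P →* A × B} (hφ : Function.Surjective φ)
    {π : Representation ℂ G V} (hπ : π.IsIrreducible) {v : V} (hv : v ≠ 0)
    (hfix : ∀ u ∈ φ.ker.map P.subtype, π u v = v) :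
    ∃ (W₁ W₂ : Type) (_ : AddCommGroup W₁) (_ : Module ℂ W₁) (_ : AddCommGroup W₂)
      (_ : Module ℂ W₂) (_ : FiniteDimensional ℂ W₁) (_ : FiniteDimensional ℂ W₂)
      (σ₁ : Representation ℂ A W₁) (σ₂ : Representation ℂ B W₂),
      IsSubrepOf π (induced P ((extTensor σ₁ σ₂).comp φ)) := by
  classical
  obtain ⟨L, hLv, hL⟩ := exists_invariant_functional_of_fixed π _ hv hfix
  -- The spaces `W₁`, `W₂` must live in `Type`, whatever the universe of `A` and `B`.
  let A' := Shrink.{0} A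
  let B' := Shrink.{0} B
  have : Finite A' := Finite.of_equiv A (equivShrink.{0} A)
  have : Finite B' := Finite.of_equiv B (equivShrink.{0} B)
  have := Fintype.ofFinite A'
  have := Fintype.ofFinite B'
  let e : A' ≃* A := Shrink.mulEquiv
  let e' : B' ≃* B := Shrink.mulEquiv
  let W₁ := A' → ℂ
  let W₂ := B' → ℂ
  let σ₁ : Representation ℂ A W₁ := (leftRegularFun A').comp e.symm.toMonoidHom
  let σ₂ : Representation ℂ B W₂ := (leftRegularFun B').comp e'.symm.toMonoidHom
  let δ : A' × B' → W₁ ⊗[ℂ] W₂ := fun x => Pi.single x.1 1 ⊗ₜ Pi.single x.2 1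
  have hδ : ∀ (p : A × B) (x : A' × B'),
      extTensor σ₁ σ₂ p (δ x) = δ (e.symm p.1 * x.1, e'.symm p.2 * x.2) := by
    intro p x
    change (leftRegularFun A' (e.symm p.1) (Pi.single x.1 1)) ⊗ₜ[ℂ]
      (leftRegularFun B' (e'.symm p.2) (Pi.single x.2 1)) = _
    rw [leftRegularFun_single, leftRegularFun_single]
  let d : A' × B' → P := fun x => Function.surjInv hφ (e x.1, e' x.2)
  have hd : ∀ x, φ (d x) = (e x.1, e' x.2) := fun x => Function.surjInv_eq hφ _
  let T₀ : V →ₗ[ℂ] (G → W₁ ⊗[ℂ] W₂) :=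
    { toFun := fun v g => ∑ x, L (π ((d x).1⁻¹ * g) v) • δ x
      map_add' := by
        intro v w
        ext g
        simp [add_smul, Finset.sum_add_distrib]
      map_smul' := by
        intro c v
        ext g
        simp [Finset.smul_sum, mul_smul] }
  have hT₀ : ∀ v, T₀ v ∈ Representation.coindV P.subtype ((extTensor σ₁ σ₂).comp φ) := by
    intro v p g
    change ∑ x, L (π ((d x).1⁻¹ * (p.1 * g)) v) • δ x =
      extTensor σ₁ σ₂ (φ p) (∑ x, L (π ((d x).1⁻¹ * g) v) • δ x)
    rw [map_sum]
    symm
    refine Fintype.sum_equiv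
      (Equiv.prodCongr (Equiv.mulLeft (e.symm (φ p).1)) (Equiv.mulLeft (e'.symm (φ p).2)))
      _ _ fun x => ?_
    rw [map_smul, hδ]
    set y := (Equiv.prodCongr (Equiv.mulLeft (e.symm (φ p).1))
      (Equiv.mulLeft (e'.symm (φ p).2))) x with hy
    change _ = L (π ((d y).1⁻¹ * (p.1 * g)) v) • δ y
    congr 1
    -- Since `φ (d y) = φ p * φ (d x)`, replacing `(d y)⁻¹ * p` by `(d x)⁻¹` does not change `L`.
    have hu : (d y)⁻¹ * p * d x ∈ φ.ker := by
      rw [MonoidHom.mem_ker, map_mul, map_mul, map_inv, hd, hd, hy]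
      ext <;> simp
    have := hL _ ⟨_, hu, rfl⟩ (π ((d x).1⁻¹ * g) v)
    rw [← this, ← Module.End.mul_apply, ← map_mul]
    simp [mul_assoc]
  let T : Representation.IntertwiningMap π (induced P ((extTensor σ₁ σ₂).comp φ)) :=
    ⟨LinearMap.codRestrict _ T₀ hT₀, fun g => by
      ext v x
      change T₀ (π g v) x = T₀ v (x * g)
      refine Finset.sum_congr rfl fun y _ => ?_
      rw [← Module.End.mul_apply, ← map_mul, mul_assoc]⟩
  refine ⟨W₁, W₂, inferInstance, inferInstance, inferInstance, inferInstance, inferInstance,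
    inferInstance, σ₁, σ₂, isSubrepOf_of_ne_zero hπ T (v := v) fun h => ?_⟩
  have h1 : T₀ v (d 1).1 = 0 := congrFun (congrArg Subtype.val h) (d 1).1
  -- The coordinate at the identity isolates the summand `L v` of the value at `d 1`.
  let Λ : W₁ ⊗[ℂ] W₂ →ₗ[ℂ] ℂ := LinearMap.mul' ℂ ℂ ∘ₗ TensorProduct.map
    (LinearMap.proj (1 : A')) (LinearMap.proj (1 : B'))
  have hΛ : ∀ x, Λ (δ x) =
      (Pi.single x.1 1 : A' → ℂ) 1 * (Pi.single x.2 1 : B' → ℂ) 1 := fun _ => rfl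
  have h2 : Λ (∑ x, L (π ((d x).1⁻¹ * (d 1).1) v) • δ x) = 0 := (congrArg Λ h1).trans (map_zero Λ)
  rw [map_sum, Finset.sum_eq_single 1] at h2
  · rw [map_smul, hΛ] at h2
    simp only [Prod.fst_one, Prod.snd_one, Pi.single_eq_same, inv_mul_cancel, map_one] at h2
    exact hLv (by simpa using h2)
  · rintro ⟨x, y⟩ - hxy
    rw [map_smul, hΛ]
    by_cases hx : x = 1
    · have hy : y ≠ 1 := fun hy => hxy (by rw [hx, hy]; rfl)
      simp [Pi.single_apply, hy.symm]
    · simp [Pi.single_apply, Ne.symm hx]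
  · simp

theorem containsTrivialOn_iff (π : Representation ℂ G V) (K : Subgroup G) :
    ContainsTrivialOn π K ↔ ∃ v : V, v ≠ 0 ∧ ∀ g ∈ K, π g v = v := by
  constructor
  · rintro ⟨f, hf⟩
    refine ⟨f 1, fun h => one_ne_zero (hf (h.trans (map_zero f).symm)), fun g hg => ?_⟩
    exact (f.isIntertwining _ _ (⟨g, hg⟩ : K) 1).symm
  · rintro ⟨v, hv, h⟩
    refine ⟨⟨LinearMap.toSpanSingleton ℂ V v, fun g => ?_⟩, ?_⟩
    · ext
      simp [h g g.2]
    · intro a b hab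
      exact smul_left_injective ℂ hv hab

end Representations

/-! ### From vectors fixed by `U_{n₁,n₂}` to geometric induction. -/

section Geometric

variable {R : Type*} {n n₁ n₂ : ℕ} (h : n₁ + n₂ = n)

theorem blockForm_submatrix [CommRing R] (M : Matrix (Fin n₁ ⊕ Fin n₂) (Fin n₁ ⊕ Fin n₂) R) :
    blockForm h (M.submatrix (blockEquiv n₁ n₂ h).symm (blockEquiv n₁ n₂ h).symm) = M := by
  simp [blockForm]

theorem submatrix_blockForm [CommRing R] (M : Matrix (Fin n) (Fin n) R) :
    (blockForm h M).submatrix (blockEquiv n₁ n₂ h).symm (blockEquiv n₁ n₂ h).symm = M := by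
  simp [blockForm]

theorem blockForm_injective [CommRing R] :
    Function.Injective fun A : Matrix (Fin n) (Fin n) R => blockForm h A :=
  fun A B hAB => by
    rw [← submatrix_blockForm h A, ← submatrix_blockForm h B]
    exact congrArg (fun M => M.submatrix (blockEquiv n₁ n₂ h).symm (blockEquiv n₁ n₂ h).symm) hAB

theorem geomPhi_surjective [CommRing R] : Function.Surjective (geomPhi R n₁ n₂ h) := by
  rintro ⟨a, b⟩
  let e := blockEquiv n₁ n₂ h
  let g : GL (Fin n) R :=
    ⟨(Matrix.fromBlocks a.1 0 0 b.1).submatrix e.symm e.symm,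
      (Matrix.fromBlocks a⁻¹.1 0 0 b⁻¹.1).submatrix e.symm e.symm,
      by simp [Matrix.submatrix_mul_equiv, Matrix.fromBlocks_multiply, -coe_units_inv],
      by simp [Matrix.submatrix_mul_equiv, Matrix.fromBlocks_multiply, -coe_units_inv]⟩
  have hg : blockForm h g.1 = Matrix.fromBlocks a.1 0 0 b.1 := blockForm_submatrix h _
  refine ⟨⟨g, ?_⟩, ?_⟩
  · change (blockForm h g.1).toBlocks₂₁ = 0
    rw [hg, Matrix.toBlocks_fromBlocks₂₁]
  · refine Prod.ext (Units.ext ?_) (Units.ext ?_)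
    · change (blockForm h g.1).toBlocks₁₁ = a.1
      rw [hg, Matrix.toBlocks_fromBlocks₁₁]
    · change (blockForm h g.1).toBlocks₂₂ = b.1
      rw [hg, Matrix.toBlocks_fromBlocks₂₂]

theorem isGeomInduced_of_fixed [CommRing R] [Finite R] (hn₁ : 0 < n₁) (hn₂ : 0 < n₂) {V : Type*}
    [AddCommGroup V] [Module ℂ V] {π : Representation ℂ (GL (Fin n) R) V} (hπ : π.IsIrreducible)
    {v : V} (hv : v ≠ 0) (hfix : ∀ u ∈ geomU R n₁ n₂ h, π u v = v) : IsGeomInduced π :=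
  ⟨n₁, n₂, h, hn₁, hn₂, isSubrepOf_induced_extTensor (geomPhi_surjective h) hπ hv hfix⟩

end Geometric

/-! ### Unipotent elements as commutators, on which characters vanish. -/

section Unipotent

variable {R : Type*} [CommRing R]

/-- The elementary matrix `1 + c Eᵢⱼ`, for `i ≠ j`, as an element of the general linear group. -/
def elementary {n : ℕ} {i j : Fin n} (hij : i ≠ j) (c : R) : GL (Fin n) R :=
  ⟨transvection i j c, transvection i j (-c),
    by rw [transvection_mul_transvection_same i j hij, add_neg_cancel, transvection_zero],
    by rw [transvection_mul_transvection_same i j hij, neg_add_cancel, transvection_zero]⟩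

theorem elementary_val {n : ℕ} {i j : Fin n} (hij : i ≠ j) (c : R) :
    (elementary hij c).val = 1 + single i j c := rfl

/-- With a third index `k`, the element is the commutator of `1 + c Eᵢₖ` and `1 + Eₖⱼ`. No unit
other than 1 is needed, so residue field `𝔽₂` is allowed. -/
theorem character_elementary {A : Type*} [CommGroup A] (χ : GL (Fin 4) R →* A) {i j : Fin 4}
    (hij : i ≠ j) (c : R) : χ (elementary hij c) = 1 := by
  obtain ⟨k, hki, hkj⟩ : ∃ k : Fin 4, k ≠ i ∧ k ≠ j := by
    revert i j
    decide
  have h : elementary hki.symm c * elementary hkj 1 =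
      elementary hij c * elementary hkj 1 * elementary hki.symm c := by
    apply Units.ext
    simp only [Units.val_mul, elementary_val, mul_add, add_mul, mul_one, one_mul,
      single_mul_single_same, single_mul_single_of_ne _ _ _ _ hij.symm,
      single_mul_single_of_ne _ _ _ _ hkj.symm, add_zero]
    abel
  have h1 := congrArg χ h
  rw [map_mul, map_mul, map_mul, mul_assoc, mul_comm (χ (elementary hkj 1))] at h1
  exact mul_eq_right.mp h1.symm

theorem mem_geomU_iff {n n₁ n₂ : ℕ} (h : n₁ + n₂ = n) (u : GL (Fin n) R) :
    u ∈ geomU R n₁ n₂ h ↔ ∃ x, blockForm h u.val = fromBlocks 1 x 0 1 := by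
  constructor
  · rintro ⟨v, hv, rfl⟩
    refine ⟨(blockForm h v.val.val).toBlocks₁₂, ?_⟩
    have h11 : (blockForm h v.val.val).toBlocks₁₁ = 1 :=
      congrArg Units.val (congrArg Prod.fst (show geomPhi R n₁ n₂ h v = 1 from hv))
    have h22 : (blockForm h v.val.val).toBlocks₂₂ = 1 :=
      congrArg Units.val (congrArg Prod.snd (show geomPhi R n₁ n₂ h v = 1 from hv))
    have h21 : (blockForm h v.val.val).toBlocks₂₁ = 0 := v.2
    conv_rhs => rw [← h11]; arg 3; rw [← h21]
    conv_rhs => arg 4; rw [← h22]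
    exact (fromBlocks_toBlocks _).symm
  · rintro ⟨x, hx⟩
    refine ⟨⟨u, ?_⟩, Prod.ext (Units.ext ?_) (Units.ext ?_), rfl⟩
    · change (blockForm h u.val).toBlocks₂₁ = 0
      rw [hx, toBlocks_fromBlocks₂₁]
    · change (blockForm h u.val).toBlocks₁₁ = 1
      rw [hx, toBlocks_fromBlocks₁₁]
    · change (blockForm h u.val).toBlocks₂₂ = 1
      rw [hx, toBlocks_fromBlocks₂₂]

theorem inv_mul_mem_geomU {n n₁ n₂ : ℕ} (h : n₁ + n₂ = n) {p u : GL (Fin n) R}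
    (hp : p ∈ geomP R n₁ n₂ h) (hu : u ∈ geomU R n₁ n₂ h) : p⁻¹ * u * p ∈ geomU R n₁ n₂ h := by
  obtain ⟨v, hv, rfl⟩ := hu
  refine Subgroup.mem_map.mpr ⟨(⟨p, hp⟩ : geomP R n₁ n₂ h)⁻¹ * v * ⟨p, hp⟩, ?_, ?_⟩
  · have hv' : geomPhi R n₁ n₂ h v = 1 := hv
    rw [MonoidHom.mem_ker, map_mul, map_mul, hv', mul_one, map_inv, inv_mul_cancel]
  · simp only [map_mul, map_inv, Subgroup.subtype_apply]

theorem elementary_mem_geomU {n n₁ n₂ : ℕ} (h : n₁ + n₂ = n) (i : Fin n₁) (j : Fin n₂)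
    (hij : blockEquiv n₁ n₂ h (Sum.inl i) ≠ blockEquiv n₁ n₂ h (Sum.inr j)) (c : R) :
    elementary hij c ∈ geomU R n₁ n₂ h := by
  rw [mem_geomU_iff]
  refine ⟨single i j c, ?_⟩
  ext (a | a) (b | b) <;> simp [blockForm, elementary_val, single_apply, one_apply]

/-- The matrix with given blocks, as an element of the general linear group. -/
def blockUnit {n n₁ n₂ : ℕ} (h : n₁ + n₂ = n) (M N : Matrix (Fin n₁ ⊕ Fin n₂) (Fin n₁ ⊕ Fin n₂) R)
    (hMN : M * N = 1) : GL (Fin n) R :=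
  ⟨M.submatrix (blockEquiv n₁ n₂ h).symm (blockEquiv n₁ n₂ h).symm,
    N.submatrix (blockEquiv n₁ n₂ h).symm (blockEquiv n₁ n₂ h).symm,
    by rw [submatrix_mul_equiv, hMN, submatrix_one_equiv],
    by rw [submatrix_mul_equiv, mul_eq_one_comm.mp hMN, submatrix_one_equiv]⟩

theorem blockForm_blockUnit {n n₁ n₂ : ℕ} (h : n₁ + n₂ = n)
    (M N : Matrix (Fin n₁ ⊕ Fin n₂) (Fin n₁ ⊕ Fin n₂) R) (hMN : M * N = 1) :
    blockForm h (blockUnit h M N hMN).val = M := blockForm_submatrix h M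

theorem character_geomU {A : Type*} [CommGroup A] {n : ℕ} (h : 2 + 2 = n)
    (χ : GL (Fin n) R →* A) {u : GL (Fin n) R} (hu : u ∈ geomU R 2 2 h) : χ u = 1 := by
  obtain ⟨x, hx⟩ := (mem_geomU_iff h u).mp hu
  -- Both `a` and `a - 1` are invertible over every commutative ring. Hence `x = (a - 1) y` is
  -- solvable, and `u` is the commutator of `diag(a, 1)` with the unipotent element of block `y`.
  let a : Matrix (Fin 2) (Fin 2) R := !![0, -1; 1, 1]
  let a' : Matrix (Fin 2) (Fin 2) R := !![1, 1; -1, 0]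
  let y : Matrix (Fin 2) (Fin 2) R := !![0, 1; -1, -1] * x
  have haa : a * a' = 1 := by simp [a, a', one_fin_two]
  have hay : a * y = y + x := by
    have h1 : (a - 1) * !![0, 1; -1, -1] = 1 := by
      ext i j
      fin_cases i <;> fin_cases j <;> simp [a, mul_apply, Fin.sum_univ_two]
    have h2 : (a - 1) * y = x := by rw [← Matrix.mul_assoc, h1, Matrix.one_mul]
    rw [Matrix.sub_mul, Matrix.one_mul, sub_eq_iff_eq_add'] at h2
    exact h2
  let d := blockUnit h (fromBlocks a 0 0 1) (fromBlocks a' 0 0 1)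
    (by simp [fromBlocks_multiply, haa])
  let v := blockUnit h (fromBlocks 1 y 0 1) (fromBlocks 1 (-y) 0 1)
    (by simp [fromBlocks_multiply])
  have key : d * v = u * v * d := by
    apply Units.ext
    apply blockForm_injective h
    simp only [Units.val_mul, blockForm_mul, d, v, blockForm_blockUnit, hx, fromBlocks_multiply]
    simp [hay]
  have h1 := congrArg χ key
  rw [map_mul, map_mul, map_mul, mul_assoc, mul_comm (χ v)] at h1
  exact mul_eq_right.mp h1.symm

end Unipotent

/-! ### Linear algebra of matrices annihilated by an irreducible quadratic polynomial. -/

section Quadratic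

variable {k : Type*} [Field k] {t m : k}

/-- Otherwise the `(i, i)` entry of the quadratic relation makes `γ i i` a root. -/
theorem exists_offDiag_row_ne_zero {ι : Type*} [Fintype ι] [DecidableEq ι]
    (hroot : ∀ x : k, x * x ≠ t * x - m) {γ : Matrix ι ι k} (hγ : γ * γ = t • γ - m • 1) (i : ι) :
    ∃ j, j ≠ i ∧ γ i j ≠ 0 := by
  by_contra! h
  refine hroot (γ i i) ?_
  have h1 := congrFun (congrFun hγ i) i
  rw [mul_apply, Finset.sum_eq_single i (fun j _ hj => by rw [h j hj, zero_mul]) (by simp)] at h1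
  simpa using h1

theorem exists_offDiag_col_ne_zero {ι : Type*} [Fintype ι] [DecidableEq ι]
    (hroot : ∀ x : k, x * x ≠ t * x - m) {γ : Matrix ι ι k} (hγ : γ * γ = t • γ - m • 1) (i : ι) :
    ∃ j, j ≠ i ∧ γ j i ≠ 0 :=
  exists_offDiag_row_ne_zero hroot (γ := γᵀ)
    (by rw [← transpose_mul, hγ]; simp) i

/-- A nonzero matrix commuting with a companion matrix of an irreducible polynomial is
invertible. -/
theorem exists_inverse_of_commute_companion (hroot : ∀ x : k, x * x ≠ t * x - m)
    {Y : Matrix (Fin 2) (Fin 2) k} (hY : !![0, -m; 1, t] * Y = Y * !![0, -m; 1, t]) (h0 : Y ≠ 0) :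
    ∃ Z, Y * Z = 1 := by
  have h00 := congrFun (congrFun hY 0) 0
  have h10 := congrFun (congrFun hY 1) 0
  simp [mul_apply, Fin.sum_univ_two] at h00 h10
  have hdet : Y.det ≠ 0 := by
    rw [det_fin_two]
    intro hd
    -- The commuting matrix is `y₀ + y₁ H`, where `y₀`, `y₁` form its first column, and its
    -- determinant is the norm form; a nontrivial zero gives the root `-y₀ / y₁`.
    have hd' : Y 0 0 * Y 0 0 + t * Y 0 0 * Y 1 0 + m * Y 1 0 * Y 1 0 = 0 := by
      rw [← h10, ← h00] at hd
      linear_combination hd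
    by_cases hz : Y 1 0 = 0
    · rw [hz] at hd' h00 h10
      have hy : Y 0 0 = 0 := by simpa using hd'
      apply h0
      ext i j
      fin_cases i <;> fin_cases j <;> simp [← h00, ← h10, hy, hz]
    · refine hroot (-Y 0 0 / Y 1 0) ?_
      field_simp
      linear_combination hd'
  exact ⟨Y⁻¹, mul_nonsing_inv Y (isUnit_iff_ne_zero.mpr hdet)⟩

/-- If `g⁻¹ diag(H, H) g` is block upper triangular, where `H` is the companion matrix of an
irreducible quadratic polynomial, then `g` is the product of a matrix commuting with `diag(H, H)`
and a block upper triangular matrix. -/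
theorem exists_commute_mul_blockTriangular (hroot : ∀ x : k, x * x ≠ t * x - m)
    {g g' γ : Matrix (Fin 2 ⊕ Fin 2) (Fin 2 ⊕ Fin 2) k} (hg : g' * g = 1)
    (hgγ : fromBlocks !![0, -m; 1, t] 0 0 !![0, -m; 1, t] * g = g * γ) (hγ : γ.toBlocks₂₁ = 0)
    (hγ2 : γ * γ = t • γ - m • 1) :
    ∃ A A' : Matrix (Fin 2 ⊕ Fin 2) (Fin 2 ⊕ Fin 2) k, A * A' = 1 ∧
      fromBlocks !![0, -m; 1, t] 0 0 !![0, -m; 1, t] * A =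
        A * fromBlocks !![0, -m; 1, t] 0 0 !![0, -m; 1, t] ∧ (A' * g).toBlocks₂₁ = 0 := by
  set H : Matrix (Fin 2) (Fin 2) k := !![0, -m; 1, t] with hH
  set X₁ := g.toBlocks₁₁ with hX₁
  set X₂ := g.toBlocks₂₁ with hX₂
  set a := γ.toBlocks₁₁ with ha
  have hgb : g = fromBlocks X₁ g.toBlocks₁₂ X₂ g.toBlocks₂₂ := (fromBlocks_toBlocks g).symm
  have hγb : γ = fromBlocks a γ.toBlocks₁₂ 0 γ.toBlocks₂₂ := by
    rw [← hγ]
    exact (fromBlocks_toBlocks γ).symm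
  have hHX := hgγ
  rw [hgb, hγb, fromBlocks_multiply, fromBlocks_multiply, fromBlocks_inj] at hHX
  obtain ⟨hHX₁, -, hHX₂, -⟩ := hHX
  simp only [Matrix.zero_mul, Matrix.mul_zero, add_zero, zero_add] at hHX₁ hHX₂
  have ha2 : a * a = t • a - m • 1 := by
    have h1 := congrArg toBlocks₁₁ hγ2
    rw [hγb, fromBlocks_multiply, toBlocks_fromBlocks₁₁] at h1
    simp only [Matrix.mul_zero, add_zero] at h1
    rw [h1]
    ext i j
    simp [toBlocks₁₁, one_apply]
  have ha10 : a 1 0 ≠ 0 := by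
    obtain ⟨j, hj, hj'⟩ := exists_offDiag_col_ne_zero hroot ha2 0
    fin_cases j
    · exact absurd rfl hj
    · exact hj'
  -- The columns are `e₁` and `a e₁`, a basis because `a 1 0 ≠ 0`; in it `a` becomes the companion
  -- matrix `H`.
  let c : Matrix (Fin 2) (Fin 2) k := !![1, a 0 0; 0, a 1 0]
  have hc : c * c⁻¹ = 1 := mul_nonsing_inv c (by simpa [c] using ha10)
  have hac : a * c = c * H := by
    have e00 := congrFun (congrFun ha2 0) 0
    have e10 := congrFun (congrFun ha2 1) 0
    simp [mul_apply, Fin.sum_univ_two] at e00 e10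
    ext i j
    fin_cases i <;> fin_cases j <;> simp [c, H, mul_apply, Fin.sum_univ_two]
    · linear_combination e00
    · linear_combination e10
  have hY : ∀ X, H * X = X * a → H * (X * c) = X * c * H := by
    intro X hX
    rw [← Matrix.mul_assoc, hX, Matrix.mul_assoc, hac, Matrix.mul_assoc]
  have hY₁ := hY X₁ hHX₁
  have hY₂ := hY X₂ hHX₂
  have hcancel : ∀ X, X = X * c * c⁻¹ := fun X => by rw [Matrix.mul_assoc, hc, Matrix.mul_one]
  -- `X₁ c` and `X₂ c` commute with `H`, hence are homogeneous coordinates over the field `k[H]` of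
  -- the line spanned by the first two columns of `g`. In each case `A` carries the standard line to
  -- this one.
  by_cases h1 : X₁ * c = 0
  · have hX0 : X₁ = 0 := by rw [hcancel X₁, h1, Matrix.zero_mul]
    have h2 : X₂ * c ≠ 0 := by
      intro h2
      have hX0' : X₂ = 0 := by rw [hcancel X₂, h2, Matrix.zero_mul]
      rw [hgb, hX0, hX0', ← fromBlocks_toBlocks g', fromBlocks_multiply, ← fromBlocks_one,
        fromBlocks_inj] at hg
      simpa using hg.1
    obtain ⟨Z, hZ⟩ := exists_inverse_of_commute_companion hroot hY₂ h2
    refine ⟨fromBlocks 0 1 (X₂ * c) 0, fromBlocks 0 Z 1 0, ?_, ?_, ?_⟩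
    · simp [fromBlocks_multiply, hZ]
    · simp [fromBlocks_multiply, hY₂]
    · rw [hgb, fromBlocks_multiply, toBlocks_fromBlocks₂₁, hX0]
      simp
  · obtain ⟨Z, hZ⟩ := exists_inverse_of_commute_companion hroot hY₁ h1
    have hX : X₂ = X₂ * c * Z * X₁ := by
      have hZ' := mul_eq_one_comm.mp hZ
      calc X₂ = X₂ * c * c⁻¹ := hcancel X₂
        _ = X₂ * c * (Z * (X₁ * c)) * c⁻¹ := by rw [hZ', Matrix.mul_one]
        _ = X₂ * c * Z * X₁ * (c * c⁻¹) := by simp only [Matrix.mul_assoc]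
        _ = _ := by rw [hc, Matrix.mul_one]
    refine ⟨fromBlocks (X₁ * c) 0 (X₂ * c) 1, fromBlocks Z 0 (-(X₂ * c * Z)) 1, ?_, ?_, ?_⟩
    · simp [fromBlocks_multiply, hZ]
    · simp [fromBlocks_multiply, hY₁, hY₂]
    · rw [hgb, fromBlocks_multiply, toBlocks_fromBlocks₂₁]
      rw [Matrix.neg_mul, ← hX]
      simp

end Quadratic

/-! ### Reduction to the residue field and lifting back. -/

section Reduction

variable {F : Type*} [Field F] [ValuativeRel F]

theorem red_mk (a : 𝒪[F]) :
    red F (Ideal.Quotient.mk (𝓂[F] ^ 2) a) = IsLocalRing.residue 𝒪[F] a := rfl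

theorem map_red_map_mk {n : ℕ} (A : Matrix (Fin n) (Fin n) 𝒪[F]) :
    (A.map (Ideal.Quotient.mk (𝓂[F] ^ 2))).map (red F) = A.map (IsLocalRing.residue 𝒪[F]) := rfl

theorem liftTwo_map_residue {n : ℕ} (A : Matrix (Fin n) (Fin n) (Ok F 2)) :
    (liftTwo A).map (IsLocalRing.residue 𝒪[F]) = A.map (red F) := by
  rw [← map_red_map_mk, liftTwo_map]

theorem isUnit_det_of_map_red {n : ℕ} (A : Matrix (Fin n) (Fin n) (Ok F 2))
    (h : IsUnit (A.map (red F)).det) : IsUnit A.det := by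
  have h1 : IsUnit (liftTwo A).det := by
    apply isUnit_of_map_unit (IsLocalRing.residue 𝒪[F])
    rwa [RingHom.map_det, RingHom.mapMatrix_apply, liftTwo_map_residue]
  have h2 := h1.map (Ideal.Quotient.mk (𝓂[F] ^ 2))
  rwa [RingHom.map_det, RingHom.mapMatrix_apply, liftTwo_map] at h2

theorem exists_GL_map_red {n : ℕ} {A A' : Matrix (Fin n) (Fin n) 𝓀[F]} (h : A * A' = 1) :
    ∃ s : GL (Fin n) (Ok F 2), s.val.map (red F) = A := by
  have hA : ((liftRes A).map (Ideal.Quotient.mk (𝓂[F] ^ 2))).map (red F) = A := by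
    rw [map_red_map_mk, liftRes_map]
  have hu : IsUnit A.det := by
    rw [← isUnit_iff_isUnit_det]
    exact IsUnit.of_mul_eq_one A' h
  exact ⟨GeneralLinearGroup.mk'' _ (isUnit_det_of_map_red _ (hA.symm ▸ hu)), hA⟩

theorem map_red_mul {n : ℕ} (g h : GL (Fin n) (Ok F 2)) :
    (g * h).val.map (red F) = g.val.map (red F) * h.val.map (red F) := by
  rw [Units.val_mul, Matrix.map_mul]

theorem map_red_inv_mul {n : ℕ} (g : GL (Fin n) (Ok F 2)) :
    g⁻¹.val.map (red F) * g.val.map (red F) = 1 := by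
  rw [← map_red_mul, inv_mul_cancel, Units.val_one]
  exact Matrix.map_one _ (map_zero _) (map_one _)

theorem map_red_mul_inv {n : ℕ} (g : GL (Fin n) (Ok F 2)) :
    g.val.map (red F) * g⁻¹.val.map (red F) = 1 := mul_eq_one_comm.mp (map_red_inv_mul g)

theorem mem_N1_iff {n : ℕ} (g : GL (Fin n) (Ok F 2)) : g ∈ N1 F n ↔ g.val.map (red F) = 1 :=
  Units.ext_iff

/-- A matrix whose reduction is block upper triangular is block upper triangular up to `N₁`. -/
theorem exists_N1_mul_geomP {n n₁ n₂ : ℕ} (h : n₁ + n₂ = n) (q : GL (Fin n) (Ok F 2))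
    (hq : (blockForm h (q.val.map (red F))).toBlocks₂₁ = 0) :
    ∃ z ∈ N1 F n, ∃ p ∈ geomP (Ok F 2) n₁ n₂ h, q = z * p := by
  let Q := blockForm h q.val
  let M : Matrix (Fin n) (Fin n) (Ok F 2) :=
    (fromBlocks Q.toBlocks₁₁ Q.toBlocks₁₂ 0 Q.toBlocks₂₂).submatrix
      (blockEquiv n₁ n₂ h).symm (blockEquiv n₁ n₂ h).symm
  have hM : M.map (red F) = q.val.map (red F) := by
    apply blockForm_injective h
    change (blockForm h M).map (red F) = _
    have h0 : (0 : Matrix (Fin n₂) (Fin n₁) (Ok F 2)).map (red F) = 0 :=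
      Matrix.map_zero _ (map_zero _)
    rw [blockForm_submatrix, fromBlocks_map, h0, ← hq]
    exact fromBlocks_toBlocks (blockForm h (q.val.map (red F)))
  have hu : IsUnit M.det := by
    apply isUnit_det_of_map_red
    rw [hM, ← isUnit_iff_isUnit_det]
    exact IsUnit.of_mul_eq_one _ (map_red_mul_inv q)
  let p : GL (Fin n) (Ok F 2) := GeneralLinearGroup.mk'' M hu
  have hp : p.val.map (red F) = q.val.map (red F) := hM
  refine ⟨q * p⁻¹, ?_, p, ?_, by group⟩
  · rw [mem_N1_iff, map_red_mul, ← hp, map_red_mul_inv]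
  · change (blockForm h M).toBlocks₂₁ = 0
    rw [blockForm_submatrix, toBlocks_fromBlocks₂₁]

theorem elementary_mem_N1 {n : ℕ} {i j : Fin n} (hij : i ≠ j) {c : Ok F 2} (hc : red F c = 0) :
    elementary hij c ∈ N1 F n := by
  rw [mem_N1_iff, elementary_val]
  rw [Matrix.map_add _ (map_add _), Matrix.map_one _ (map_zero _) (map_one _), map_single, hc,
    single_zero, add_zero]

theorem exists_infPhi_eq_one {k n : ℕ} {lam : Fin n → ℕ} {u : GL (Fin n) (Ok F k)}
    (h : ∀ v ∈ partSubmodule F k lam, u.val *ᵥ v = v) :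
    ∃ hu : u ∈ infP F k lam, infPhi F k lam ⟨u, hu⟩ = 1 := by
  refine ⟨?_, Units.ext (LinearMap.ext fun v => Subtype.ext (h v.1 v.2))⟩
  ext v
  rw [Submodule.mem_map]
  constructor
  · rintro ⟨w, hw, rfl⟩
    rwa [mulVecLin_apply, h w hw]
  · exact fun hv => ⟨v, hv, h v hv⟩

/-- As `lam i < 2`, the `i`-th coordinates of vectors in `𝔬_λ` lie in the maximal ideal, whose
square is zero in `𝔬_2`; so they are killed by `c`. -/
theorem elementary_mulVec_eq_self {n : ℕ} {lam : Fin n → ℕ} {i j : Fin n} (hji : j ≠ i)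
    (hi : lam i < 2) {c : Ok F 2} (hc : red F c = 0) :
    ∀ v ∈ partSubmodule F 2 lam, (elementary hji c).val *ᵥ v = v := by
  intro v hv
  have hvi : v i ∈ (𝓂[F] ^ (2 - lam i)).map (Ideal.Quotient.mk (𝓂[F] ^ 2)) := hv i trivial
  rw [Ideal.mem_map_iff_of_surjective _ Ideal.Quotient.mk_surjective] at hvi
  obtain ⟨a, ha, hav⟩ := hvi
  have ha1 : a ∈ 𝓂[F] := Ideal.pow_le_self (by omega) ha
  obtain ⟨c, rfl⟩ := Ideal.Quotient.mk_surjective c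
  rw [red_mk, IsLocalRing.residue_eq_zero_iff] at hc
  have h0 : Ideal.Quotient.mk (𝓂[F] ^ 2) c * v i = 0 := by
    rw [← hav, ← map_mul, Ideal.Quotient.eq_zero_iff_mem, pow_two]
    exact Ideal.mul_mem_mul hc ha1
  rw [elementary_val, add_mulVec, one_mulVec, single_mulVec, h0]
  simp

end Reduction

/-! ### The characters `ψ_β` under conjugation and on elementary matrices. -/

section Characters

variable {F : Type*} [Field F] [ValuativeRel F] [TopologicalSpace F] [IsNonarchimedeanLocalField F]

instance : Finite (Ok F 2) :=
  have : Finite (𝒪[F] ⧸ 𝓂[F]) := inferInstanceAs (Finite 𝓀[F])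
  Ideal.finite_quotient_pow (IsNoetherian.noetherian _) 2

variable {ψ : AddChar F ℂ} (hψ : ∀ x : 𝒪[F], ψ (x : F) = 1) {ϖ : 𝒪[F]} (hϖ : Irreducible ϖ)

/-- This is cyclicity of the trace. The chosen lifts of `g` and `g⁻¹` are inverse only modulo `𝔭²`,
and the resulting error lies in `𝔭²`, where it does not affect `ψ`. -/
theorem psi_conj {n : ℕ} {β γ : Matrix (Fin n) (Fin n) 𝓀[F]} {g : GL (Fin n) (Ok F 2)}
    (hg : β * g.val.map (red F) = g.val.map (red F) * γ) (z : N1 F n) :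
    psi ψ hψ ϖ hϖ β (MulAut.conjNormal g z) = psi ψ hψ ϖ hϖ γ z := by
  apply Units.ext
  change psiFun ψ ϖ β _ = psiFun ψ ϖ γ _
  set B := liftRes β with hB
  set Y := liftTwo g.val with hY
  set Y' := liftTwo g⁻¹.val with hY'
  set Z := liftTwo z.val.val with hZ
  have hBm : B.map (IsLocalRing.residue 𝒪[F]) = β := liftRes_map β
  have h1 : (Y * Z * Y').map (Ideal.Quotient.mk (𝓂[F] ^ 2)) =
      (MulAut.conjNormal g z : N1 F n).val.val := by
    rw [Matrix.map_mul, Matrix.map_mul, liftTwo_map, liftTwo_map, liftTwo_map,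
      MulAut.conjNormal_apply]
    rfl
  have h2 : (Y' * B * Y).map (IsLocalRing.residue 𝒪[F]) = γ := by
    rw [Matrix.map_mul, Matrix.map_mul, hBm, liftTwo_map_residue, liftTwo_map_residue,
      Matrix.mul_assoc, hg, ← Matrix.mul_assoc, map_red_inv_mul, Matrix.one_mul]
  have e1 := psiFun_lift hψ hϖ B (Y * Z * Y') _ h1
  have e2 := psiFun_lift hψ hϖ (Y' * B * Y) Z z (liftTwo_map _)
  rw [hBm] at e1
  rw [h2] at e2
  rw [e1, e2]
  refine psi_congr hψ hϖ ?_
  have key : (B * (Y * Z * Y' - 1)).trace - (Y' * B * Y * (Z - 1)).trace =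
      (B * (Y * Y' - 1)).trace := by
    have h3 : (Y' * B * Y * (Z - 1)).trace = (B * Y * (Z - 1) * Y').trace := by
      rw [Matrix.mul_assoc, Matrix.mul_assoc, Matrix.trace_mul_comm]
      simp only [Matrix.mul_assoc]
    rw [h3, ← Matrix.trace_sub]
    congr 1
    noncomm_ring
  rw [key]
  refine trace_congr (I := ⊤) (K := 𝓂[F] ^ 2) Ideal.mul_le_right (fun _ _ => trivial) fun i j => ?_
  have h4 : (Y * Y').map (Ideal.Quotient.mk (𝓂[F] ^ 2)) = 1 := by
    rw [Matrix.map_mul, liftTwo_map, liftTwo_map, ← Units.val_mul, mul_inv_cancel, Units.val_one]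
  rw [← Ideal.Quotient.eq_zero_iff_mem, Matrix.sub_apply, map_sub]
  have h5 := congrFun (congrFun h4 i) j
  rw [Matrix.map_apply] at h5
  rw [h5, one_apply, one_apply]
  split_ifs <;> simp

theorem N1_le_Gpsi {n : ℕ} (β : Matrix (Fin n) (Fin n) 𝓀[F]) : N1 F n ≤ Gpsi ψ hψ ϖ hϖ β := by
  intro g hg z
  have : MulAut.conjNormal g z = ⟨g, hg⟩ * z * ⟨g, hg⟩⁻¹ := Subtype.ext rfl
  rw [this, map_mul, map_mul, map_inv, mul_right_comm, mul_inv_cancel, one_mul]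

theorem mem_Gpsi_of_commute {n : ℕ} {β : Matrix (Fin n) (Fin n) 𝓀[F]} {g : GL (Fin n) (Ok F 2)}
    (hg : β * g.val.map (red F) = g.val.map (red F) * β) : g ∈ Gpsi ψ hψ ϖ hϖ β :=
  fun z => psi_conj hψ hϖ hg z

theorem eq_zero_of_psi_elementary (hψ' : ∃ x : 𝒪[F], ψ ((ϖ : F)⁻¹ * (x : F)) ≠ 1) {n : ℕ}
    {γ : Matrix (Fin n) (Fin n) 𝓀[F]} {i j : Fin n} (hij : i ≠ j)
    (h : ∀ z : N1 F n, (∃ c, red F c = 0 ∧ z.val = elementary hij c) →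
      psi ψ hψ ϖ hϖ γ z = 1) : γ j i = 0 := by
  by_contra hne
  have hB : (liftRes γ).map (IsLocalRing.residue 𝒪[F]) = γ := liftRes_map γ
  have hu : IsUnit (liftRes γ j i) := by
    apply isUnit_of_map_unit (IsLocalRing.residue 𝒪[F])
    have := congrFun (congrFun hB j) i
    rw [Matrix.map_apply] at this
    rw [this]
    exact isUnit_iff_ne_zero.mpr hne
  obtain ⟨x, hx⟩ := hψ'
  obtain ⟨b, hb⟩ := hu.exists_right_inv
  -- Here `b` inverts the lift of `γ j i`, so the entry `ϖ b x` gives trace `x` against `γ` and the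
  -- value `ψ (ϖ⁻¹ x) ≠ 1`.
  have hc : red F (Ideal.Quotient.mk (𝓂[F] ^ 2) (ϖ * (b * x))) = 0 := by
    rw [red_mk, map_mul, (IsLocalRing.residue_eq_zero_iff ϖ).mpr, zero_mul]
    rw [hϖ.maximalIdeal_eq]
    exact Ideal.mem_span_singleton_self ϖ
  have h1 := h ⟨_, elementary_mem_N1 hij hc⟩ ⟨_, hc, rfl⟩
  have h2 := psiFun_eq hψ hϖ (liftRes γ) (single i j (b * x)) ⟨_, elementary_mem_N1 hij hc⟩ (by
    rw [elementary_val]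
    rw [Matrix.map_add _ (map_add _), Matrix.map_one _ (map_zero _) (map_one _), smul_single,
      map_single, smul_eq_mul])
  rw [hB] at h2
  have h3 : (liftRes γ * single i j (b * x)).trace = x := by
    exact (trace_mul_single _ _ _ _).trans (by
      rw [op_smul_eq_mul, ← mul_assoc, hb, one_mul])
  rw [h3] at h2
  exact hx (h2.symm.trans (congrArg Units.val h1))

end Characters

/-! ### The matrix `β₂` and its quadratic relation. -/

section Beta

/-- The matrix of multiplication by a generator `η` of a quadratic extension, in the basis
`{1, η}`, is the companion matrix of a quadratic polynomial without roots. -/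
theorem exists_leftMulMatrix_eq_companion {k E : Type*} [Field k] [Field E] [Algebra k E] {η : E}
    (b : Module.Basis (Fin 2) k E) (hb : ⇑b = ![1, η]) :
    ∃ t m : k, Algebra.leftMulMatrix b η = !![0, -m; 1, t] ∧ ∀ x : k, x * x ≠ t * x - m := by
  have hb0 : b 0 = 1 := by rw [hb]; rfl
  have hb1 : b 1 = η := by rw [hb]; rfl
  refine ⟨b.repr (η * η) 1, -b.repr (η * η) 0, ?_, fun x hx => ?_⟩
  · ext i j
    rw [Algebra.leftMulMatrix_eq_repr_mul]
    fin_cases i <;> fin_cases j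
    · change b.repr (η * b 0) 0 = 0
      rw [hb0, mul_one, ← hb1, b.repr_self]
      simp
    · change b.repr (η * b 1) 0 = - -b.repr (η * η) 0
      rw [hb1, neg_neg]
    · change b.repr (η * b 0) 1 = 1
      rw [hb0, mul_one, ← hb1, b.repr_self]
      simp
    · change b.repr (η * b 1) 1 = b.repr (η * η) 1
      rw [hb1]
  · have hne : ∀ c : k, η ≠ algebraMap k E c := by
      intro c hc
      have h1 : b 1 = c • b 0 := by rw [hb0, hb1, hc, Algebra.algebraMap_eq_smul_one]
      have h2 := congrArg (fun v => b.repr v 1) h1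
      simp at h2
    have hsum := b.sum_repr (η * η)
    rw [Fin.sum_univ_two, hb0, hb1, Algebra.smul_def, Algebra.smul_def, mul_one] at hsum
    have hx' := congrArg (algebraMap k E) hx
    simp only [map_mul, map_sub, map_neg] at hx'
    -- A root `x` in `k` splits the polynomial as `(X - x)(X - (t - x))`, which would put its zero
    -- `η` in `k`.
    have : (η - algebraMap k E x) * (η - algebraMap k E (b.repr (η * η) 1 - x)) = 0 := by
      rw [map_sub]
      linear_combination -hsum - hx'
    rcases mul_eq_zero.mp this with h | h
    · exact hne _ (sub_eq_zero.mp h)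
    · exact hne _ (sub_eq_zero.mp h)

theorem blockForm_diagTwo {R : Type*} [CommRing R] (A : Matrix (Fin 2) (Fin 2) R) :
    blockForm rfl (diagTwo A) = fromBlocks A 0 0 A := blockForm_submatrix rfl _

theorem diagTwo_companion_sq {k : Type*} [Field k] (t m : k) :
    diagTwo !![0, -m; 1, t] * diagTwo !![0, -m; 1, t] =
      t • diagTwo !![0, -m; 1, t] - m • (1 : Matrix (Fin 4) (Fin 4) k) := by
  have h : (!![0, -m; 1, t] : Matrix (Fin 2) (Fin 2) k) * !![0, -m; 1, t] =
      t • !![0, -m; 1, t] - m • 1 := by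
    ext i j
    fin_cases i <;> fin_cases j <;> simp [mul_apply, Fin.sum_univ_two, sub_eq_neg_add, mul_comm]
  have e : 2 + 2 = 4 := rfl
  set D : Matrix (Fin 4) (Fin 4) k := diagTwo !![0, -m; 1, t]
  have hD : blockForm e D = fromBlocks !![0, -m; 1, t] 0 0 !![0, -m; 1, t] := blockForm_diagTwo _
  refine blockForm_injective e ((blockForm_mul e D D).trans ?_)
  change _ = t • blockForm e D - m • blockForm e (1 : Matrix (Fin 4) (Fin 4) k)
  rw [hD, fromBlocks_multiply, blockForm_one, ← fromBlocks_one, fromBlocks_smul, fromBlocks_smul,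
    sub_eq_add_neg, fromBlocks_neg, fromBlocks_add, h]
  simp [sub_eq_add_neg]

end Beta

/-! ### Functions in the induced representation, and their behaviour under `N₁`. -/

section Main

variable {F : Type*} [Field F] [ValuativeRel F] [TopologicalSpace F] [IsNonarchimedeanLocalField F]
  {ϖ : 𝒪[F]} {hϖ : Irreducible ϖ} {ψ : AddChar F ℂ} {hψ : ∀ x : 𝒪[F], ψ (x : F) = 1}
  {n : ℕ} {β γ : Matrix (Fin n) (Fin n) 𝓀[F]} {W : Type*} [AddCommGroup W] [Module ℂ W]
  {ρ : Representation ℂ (Gpsi ψ hψ ϖ hϖ β) W}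

/-- Write `x z = (x z x⁻¹) x`: the conjugate lies in `N₁` and acts by `ψ_β`, which becomes `ψ_γ`
after undoing the conjugation. -/
theorem coindV_apply_mul_N1
    (hρ_N1 : ∀ (g : Gpsi ψ hψ ϖ hϖ β) (hg : g.val ∈ N1 F n) (w : W),
      ρ g w = (psi ψ hψ ϖ hϖ β ⟨g.val, hg⟩ : ℂ) • w)
    (f : Representation.coindV (Gpsi ψ hψ ϖ hϖ β).subtype ρ) {x : GL (Fin n) (Ok F 2)}
    (hx : β * x.val.map (red F) = x.val.map (red F) * γ) (z : N1 F n) :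
    f.1 (x * z) = (psi ψ hψ ϖ hϖ γ z : ℂ) • f.1 x := by
  let c : N1 F n := MulAut.conjNormal x z
  have hc : x * z = c.1 * x := by
    simp [c, MulAut.conjNormal_apply]
  have h1 := f.2 ⟨c.1, N1_le_Gpsi hψ hϖ β c.2⟩ x
  rw [hρ_N1 _ c.2] at h1
  rw [hc, ← psi_conj hψ hϖ hx z]
  exact h1

theorem offDiag_eq_zero_of_fixed (hψ' : ∃ x : 𝒪[F], ψ ((ϖ : F)⁻¹ * (x : F)) ≠ 1)
    (hρ_N1 : ∀ (g : Gpsi ψ hψ ϖ hϖ β) (hg : g.val ∈ N1 F n) (w : W),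
      ρ g w = (psi ψ hψ ϖ hϖ β ⟨g.val, hg⟩ : ℂ) • w)
    (f : Representation.coindV (Gpsi ψ hψ ϖ hϖ β).subtype ρ) {x : GL (Fin n) (Ok F 2)}
    (hx : β * x.val.map (red F) = x.val.map (red F) * γ) (hfx : f.1 x ≠ 0) {i j : Fin n}
    (hij : i ≠ j) (h : ∀ c, red F c = 0 → f.1 (x * elementary hij c) = f.1 x) : γ j i = 0 := by
  refine eq_zero_of_psi_elementary hψ hϖ hψ' hij ?_
  rintro z ⟨c, hc, hz⟩
  have h1 := coindV_apply_mul_N1 hρ_N1 f hx z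
  rw [hz, h c hc] at h1
  apply Units.ext
  have h2 : ((psi ψ hψ ϖ hϖ γ z : ℂ) - 1) • f.1 x = 0 := by
    rw [sub_smul, one_smul, ← h1, sub_self]
  exact sub_eq_zero.mp ((smul_eq_zero.mp h2).resolve_right hfx)

/-- A vector of the twist of an induced representation fixed by a set of elements, as a function
on the group. -/
theorem exists_fixed_function {G V : Type*} [Group G] [AddCommGroup V] [Module ℂ V]
    {π : Representation ℂ G V} {S : Subgroup G} {ρ : Representation ℂ S W}
    (e : π.Equiv (induced S ρ)) (χ : G →* ℂˣ) {v : V} (hv : v ≠ 0) :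
    ∃ (f : Representation.coindV S.subtype ρ) (x : G), f.1 x ≠ 0 ∧
      ∀ u, twist χ π u v = v → χ u = 1 → ∀ y, f.1 (y * u) = f.1 y := by
  have hf : e v ≠ 0 := fun h => hv (e.injective (h.trans (map_zero e).symm))
  obtain ⟨x, hx⟩ : ∃ x, (e v).1 x ≠ 0 := by
    by_contra! h
    exact hf (Subtype.ext (funext h))
  refine ⟨e v, x, hx, fun u hu hχ y => ?_⟩
  have h1 : π u v = v := by
    change (χ u : ℂ) • π u v = v at hu
    rwa [hχ, Units.val_one, one_smul] at hu
  have h2 : e (π u v) = induced S ρ u (e v) := e.toIntertwiningMap.isIntertwining _ _ u v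
  rw [h1] at h2
  exact (congrFun (congrArg Subtype.val h2) y).symm

theorem isGeomInduced_of_containsTrivialOn {β : Matrix (Fin 4) (Fin 4) 𝓀[F]}
    {ρ : Representation ℂ (Gpsi ψ hψ ϖ hϖ β) W} {V : Type*} [AddCommGroup V] [Module ℂ V]
    {π : Representation ℂ (GL (Fin 4) (Ok F 2)) V} (hπ : π.IsIrreducible)
    (e : π.Equiv (induced (Gpsi ψ hψ ϖ hϖ β) ρ))
    (h : ContainsTrivialOn ρ ((geomU (Ok F 2) 2 2 rfl).subgroupOf (Gpsi ψ hψ ϖ hϖ β))) :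
    IsGeomInduced π := by
  obtain ⟨w, hw, hfix⟩ := (containsTrivialOn_iff _ _).mp h
  obtain ⟨f, hf, hfU⟩ := exists_fixed_induced ρ (geomU (Ok F 2) 2 2 rfl) hw
    fun s hs => hfix s hs
  refine isGeomInduced_of_fixed (show 2 + 2 = 4 from rfl) two_pos two_pos hπ
    (v := e.symm f) (fun h0 => hf (e.symm.injective (h0.trans (map_zero e.symm).symm)))
    fun u hu => ?_
  have h2 : e.symm (induced _ ρ u f) = π u (e.symm f) :=
    e.symm.toIntertwiningMap.isIntertwining _ _ u f
  rw [← h2, hfU u hu]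

end Main

/-! ### Excluding infinitesimal induction and analysing geometric induction for `β₂`. -/

section Quadratic

variable {F : Type*} [Field F] [ValuativeRel F] [TopologicalSpace F] [IsNonarchimedeanLocalField F]
  {ϖ : 𝒪[F]} {hϖ : Irreducible ϖ} {ψ : AddChar F ℂ} {hψ : ∀ x : 𝒪[F], ψ (x : F) = 1}
  {t m : 𝓀[F]} {W : Type*} [AddCommGroup W] [Module ℂ W]
  {ρ : Representation ℂ (Gpsi ψ hψ ϖ hϖ (diagTwo !![0, -m; 1, t])) W}

theorem conj_diagTwo_companion (t m : 𝓀[F]) (x : GL (Fin 4) (Ok F 2)) :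
    ∃ γ : Matrix (Fin 4) (Fin 4) 𝓀[F],
      diagTwo !![0, -m; 1, t] * x.val.map (red F) = x.val.map (red F) * γ ∧
      γ * γ = t • γ - m • 1 := by
  set β : Matrix (Fin 4) (Fin 4) 𝓀[F] := diagTwo !![0, -m; 1, t] with hβ
  set X := x.val.map (red F) with hX
  set X' := x⁻¹.val.map (red F) with hX'
  have h1 : X * X' = 1 := map_red_mul_inv x
  have h2 : X' * X = 1 := map_red_inv_mul x
  refine ⟨X' * β * X, ?_, ?_⟩
  · rw [← Matrix.mul_assoc, ← Matrix.mul_assoc, h1, Matrix.one_mul]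
  · calc X' * β * X * (X' * β * X) = X' * β * (X * X') * β * X := by
          simp only [Matrix.mul_assoc]
      _ = X' * (β * β) * X := by rw [h1, Matrix.mul_one, Matrix.mul_assoc X' β β]
      _ = _ := by
        rw [hβ, diagTwo_companion_sq, ← hβ, Matrix.mul_sub, Matrix.sub_mul, Matrix.mul_smul,
          Matrix.smul_mul, Matrix.mul_smul, Matrix.smul_mul, Matrix.mul_one, h2]

/-- At an index `i` with `lam i < 2`, every `1 + c Eⱼᵢ` with `c` in the maximal ideal acts trivially
on `𝔬_λ`, hence fixes the vector. Row `i` of `γ` would then vanish off the diagonal. -/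
theorem not_isInfInduced_twist (hroot : ∀ x : 𝓀[F], x * x ≠ t * x - m)
    (hψ' : ∃ x : 𝒪[F], ψ ((ϖ : F)⁻¹ * (x : F)) ≠ 1)
    (hρ_N1 : ∀ (g : Gpsi ψ hψ ϖ hϖ (diagTwo !![0, -m; 1, t])) (hg : g.val ∈ N1 F 4) (w : W),
      ρ g w = (psi ψ hψ ϖ hϖ (diagTwo !![0, -m; 1, t]) ⟨g.val, hg⟩ : ℂ) • w)
    {V : Type*} [AddCommGroup V] [Module ℂ V] [Nontrivial V]
    {π : Representation ℂ (GL (Fin 4) (Ok F 2)) V}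
    (e : π.Equiv (induced (Gpsi ψ hψ ϖ hϖ (diagTwo !![0, -m; 1, t])) ρ))
    (χ : GL (Fin 4) (Ok F 2) →* ℂˣ) : ¬ IsInfInduced (twist χ π) := by
  rintro ⟨lam, -, hle, -, ⟨i, hi⟩, W', _, _, _, σ, hσ⟩
  obtain ⟨v, hv, hfix⟩ := exists_fixed_of_isSubrepOf_induced hσ
  obtain ⟨f, x, hfx, hf⟩ := exists_fixed_function e χ hv
  obtain ⟨γ, hγ, hγ2⟩ := conj_diagTwo_companion t m x
  obtain ⟨j, hji, hij⟩ := exists_offDiag_row_ne_zero hroot hγ2 i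
  refine hij (offDiag_eq_zero_of_fixed hψ' hρ_N1 f hγ hfx hji fun c hc => ?_)
  obtain ⟨hu, hu1⟩ := exists_infPhi_eq_one
    (elementary_mulVec_eq_self hji (lt_of_le_of_ne (hle i) hi) hc)
  refine hf _ (hfix ⟨_, hu⟩ ?_) (character_elementary χ hji c) x
  rw [MonoidHom.comp_apply, hu1, map_one]

theorem containsTrivialOn_of_isGeomInduced_twist (hroot : ∀ x : 𝓀[F], x * x ≠ t * x - m)
    (hψ' : ∃ x : 𝒪[F], ψ ((ϖ : F)⁻¹ * (x : F)) ≠ 1)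
    (hρ_N1 : ∀ (g : Gpsi ψ hψ ϖ hϖ (diagTwo !![0, -m; 1, t])) (hg : g.val ∈ N1 F 4) (w : W),
      ρ g w = (psi ψ hψ ϖ hϖ (diagTwo !![0, -m; 1, t]) ⟨g.val, hg⟩ : ℂ) • w)
    {V : Type*} [AddCommGroup V] [Module ℂ V] [Nontrivial V]
    {π : Representation ℂ (GL (Fin 4) (Ok F 2)) V}
    (e : π.Equiv (induced (Gpsi ψ hψ ϖ hϖ (diagTwo !![0, -m; 1, t])) ρ))
    (χ : GL (Fin 4) (Ok F 2) →* ℂˣ) (h : IsGeomInduced (twist χ π)) :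
    ContainsTrivialOn ρ ((geomU (Ok F 2) 2 2 rfl).subgroupOf
      (Gpsi ψ hψ ϖ hϖ (diagTwo !![0, -m; 1, t]))) := by
  obtain ⟨n₁, n₂, h, hn₁, hn₂, W₁, W₂, _, _, _, _, _, _, σ₁, σ₂, hσ⟩ := h
  obtain ⟨v, hv, hfix⟩ := exists_fixed_of_isSubrepOf_induced hσ
  obtain ⟨f, x, hfx, hf⟩ := exists_fixed_function e χ hv
  obtain ⟨γ, hγ, hγ2⟩ := conj_diagTwo_companion t m x
  have hfixU : ∀ u ∈ geomU (Ok F 2) n₁ n₂ h, twist χ π u v = v := by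
    rintro _ ⟨u, hu, rfl⟩
    refine hfix u ?_
    change extTensor σ₁ σ₂ (geomPhi (Ok F 2) n₁ n₂ h u) = 1
    rw [show geomPhi (Ok F 2) n₁ n₂ h u = 1 from hu, map_one]
  have hne : ∀ i j, blockEquiv n₁ n₂ h (Sum.inl i) ≠ blockEquiv n₁ n₂ h (Sum.inr j) :=
    fun i j hij => Sum.inl_ne_inr ((blockEquiv n₁ n₂ h).injective hij)
  have hγ21 : ∀ i j, γ (blockEquiv n₁ n₂ h (Sum.inr j)) (blockEquiv n₁ n₂ h (Sum.inl i)) = 0 :=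
    fun i j => offDiag_eq_zero_of_fixed hψ' hρ_N1 f hγ hfx (hne i j) fun c _ =>
      hf _ (hfixU _ (elementary_mem_geomU h i j (hne i j) c)) (character_elementary χ _ c) x
  -- A block of size 1 would make the first column of `γ` vanish off the diagonal, or for `n₂ = 1`
  -- its last row.
  have h1 : n₁ ≠ 1 := by
    rintro rfl
    obtain ⟨j, hj, hj'⟩ := exists_offDiag_col_ne_zero hroot hγ2 (blockEquiv 1 n₂ h (Sum.inl 0))
    obtain ⟨j | j, rfl⟩ := (blockEquiv 1 n₂ h).surjective j
    · exact hj (by rw [Subsingleton.elim j 0])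
    · exact hj' (hγ21 0 j)
  have h2 : n₂ ≠ 1 := by
    rintro rfl
    obtain ⟨j, hj, hj'⟩ := exists_offDiag_row_ne_zero hroot hγ2 (blockEquiv n₁ 1 h (Sum.inr 0))
    obtain ⟨j | j, rfl⟩ := (blockEquiv n₁ 1 h).surjective j
    · exact hj' (hγ21 j 0)
    · exact hj (by rw [Subsingleton.elim j 0])
  obtain rfl : n₁ = 2 := by omega
  obtain rfl : n₂ = 2 := by omega
  obtain ⟨A, A', hAA, hAβ, hA⟩ := exists_commute_mul_blockTriangular hroot
    (g := blockForm h (x.val.map (red F))) (g' := blockForm h (x⁻¹.val.map (red F)))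
    (γ := blockForm h γ) (by rw [← blockForm_mul, map_red_inv_mul, blockForm_one])
    (by rw [← blockForm_diagTwo, ← blockForm_mul, ← blockForm_mul, hγ])
    (by ext j i; exact hγ21 i j)
    (by
      rw [← blockForm_mul, hγ2]
      change t • blockForm h γ - m • blockForm h 1 = _
      rw [blockForm_one])
  let e₄ := blockEquiv 2 2 h
  obtain ⟨s, hs⟩ := exists_GL_map_red (F := F) (A := A.submatrix e₄.symm e₄.symm)
    (A' := A'.submatrix e₄.symm e₄.symm) (by rw [submatrix_mul_equiv, hAA, submatrix_one_equiv])
  have hsA : blockForm h (s.val.map (red F)) = A := by rw [hs, blockForm_submatrix]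
  have hsA' : blockForm h (s⁻¹.val.map (red F)) = A' := by
    have h3 : blockForm h (s⁻¹.val.map (red F)) * A = 1 := by
      rw [← hsA, ← blockForm_mul, map_red_inv_mul, blockForm_one]
    exact left_inv_eq_right_inv h3 hAA
  have hsG : s ∈ Gpsi ψ hψ ϖ hϖ (diagTwo !![0, -m; 1, t]) := by
    refine mem_Gpsi_of_commute hψ hϖ (blockForm_injective h ?_)
    change blockForm h (_ * _) = blockForm h (_ * _)
    rw [blockForm_mul, blockForm_mul, hsA, blockForm_diagTwo, hAβ]
  -- Block triangularity of `s⁻¹ x` holds only after reduction; the error `z` is harmless because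
  -- `N₁` lies in `G(ψ_β)`.
  obtain ⟨z, hz, p, hp, hq⟩ := exists_N1_mul_geomP h (s⁻¹ * x)
    (by rw [map_red_mul, blockForm_mul, hsA', hA])
  have hxp : x = s * z * p := by rw [mul_assoc, ← hq, mul_inv_cancel_left]
  have hfp : f.1 p ≠ 0 := by
    intro h0
    apply hfx
    have := f.2 ⟨s * z, mul_mem hsG (N1_le_Gpsi hψ hϖ _ hz)⟩ p
    rw [h0, map_zero] at this
    rw [hxp]
    exact this
  -- Since `P_{2,2}` normalizes `U_{2,2}`, `ρ u (f p) = f (u p) = f (p (p⁻¹ u p)) = f p`.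
  refine (containsTrivialOn_iff _ _).mpr ⟨f.1 p, hfp, fun u hu => ?_⟩
  have hu' : p⁻¹ * u.1 * p ∈ geomU (Ok F 2) 2 2 h := inv_mul_mem_geomU h hp hu
  have h4 := hf _ (hfixU _ hu') (character_geomU h χ hu') p
  have h5 : p * (p⁻¹ * u.1 * p) = u.1 * p := by group
  rw [h5] at h4
  exact (f.2 u p).symm.trans h4

end Quadratic

end

end CuspidalGL

theorem mainTheorem8
    (F : Type*) [Field F] [ValuativeRel F] [TopologicalSpace F] [IsNonarchimedeanLocalField F]
    (ϖ : 𝒪[F]) (hϖ : Irreducible ϖ)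
    (ψ : AddChar F ℂ) (hψ : ∀ x : 𝒪[F], ψ (x : F) = 1)
    (hψ_nontrivial : ∃ x : 𝒪[F], ψ ((ϖ : F)⁻¹ * (x : F)) ≠ 1)
    (E : Type*) [Field E] [Algebra 𝓀[F] E] (hE : Module.finrank 𝓀[F] E = 2)
    (η : E) (hη : IntermediateField.adjoin 𝓀[F] {η} = ⊤)
    (b : Module.Basis (Fin 2) 𝓀[F] E) (hb : ⇑b = ![1, η])
    (V : Type*) [AddCommGroup V] [Module ℂ V]
    (π : Representation ℂ (GL (Fin 4) (CuspidalGL.Ok F 2)) V) (hπ : π.IsIrreducible)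
    (hπ_orbit : CuspidalGL.beta2 b η ∈ CuspidalGL.orbit ψ hψ ϖ hϖ π)
    (W : Type*) [AddCommGroup W] [Module ℂ W]
    (ρ : Representation ℂ (CuspidalGL.Gpsi ψ hψ ϖ hϖ (CuspidalGL.beta2 b η)) W)
    (hρ : ρ.IsIrreducible)
    (hρ_N1 : ∀ (g : CuspidalGL.Gpsi ψ hψ ϖ hϖ (CuspidalGL.beta2 b η))
      (hg : g.val ∈ CuspidalGL.N1 F 4) (w : W),
      ρ g w = (CuspidalGL.psi ψ hψ ϖ hϖ (CuspidalGL.beta2 b η) ⟨g.val, hg⟩ : ℂ) • w)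
    (hπ_ind : Nonempty (π.Equiv
      (CuspidalGL.induced (CuspidalGL.Gpsi ψ hψ ϖ hϖ (CuspidalGL.beta2 b η)) ρ))) :
    CuspidalGL.IsCuspidal π ↔
      ¬ CuspidalGL.ContainsTrivialOn ρ
        ((CuspidalGL.geomU (CuspidalGL.Ok F 2) 2 2 rfl).subgroupOf
          (CuspidalGL.Gpsi ψ hψ ϖ hϖ (CuspidalGL.beta2 b η))) := by
  obtain ⟨e⟩ := hπ_ind
  obtain ⟨t, m, hH, hroot⟩ := CuspidalGL.exists_leftMulMatrix_eq_companion b hb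
  have hβ : CuspidalGL.beta2 b η = CuspidalGL.diagTwo !![0, -m; 1, t] :=
    congrArg CuspidalGL.diagTwo hH
  have : Nontrivial V := by
    obtain ⟨v, hv, -⟩ := hπ_orbit
    exact ⟨v, 0, hv⟩
  -- The type of `ρ` depends on `β₂`, so the companion form is substituted for a variable.
  generalize CuspidalGL.beta2 b η = β at *
  subst hβ
  constructor
  · intro hc h
    have h1 := CuspidalGL.isGeomInduced_of_containsTrivialOn hπ e h
    have h2 : CuspidalGL.twist 1 π = π := by
      ext
      simp [CuspidalGL.twist]
    exact (hc.2 1).1 (h2.symm ▸ h1)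
  · intro h
    exact ⟨hπ, fun χ =>
      ⟨fun hg => h (CuspidalGL.containsTrivialOn_of_isGeomInduced_twist hroot hψ_nontrivial
          hρ_N1 e χ hg),
        CuspidalGL.not_isInfInduced_twist hroot hψ_nontrivial hρ_N1 e χ⟩⟩
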